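/- Let $d,k\in\mathbb N$ and $A,B\in\mathrm{SU}(d)$. Let $\omega=\omega_1\omega_2\cdots=0110\,1001\cdots$ be the Thue--Morse word (the limit of $W_0=0$, $W_{n+1}=W_n\overline{W_n}$, the bar denoting bitwise negation), and put $V^{[0]}=A$, $V^{[1]}=B$, $$U(t)=V^{[\omega_t]}\cdots V^{[\omega_2]}V^{[\omega_1]},\qquad \mathcal N_T[X]=\frac1T\sum_{t=0}^{T-1}U(t)^{\otimes k}\,X\,U(t)^{\dagger\otimes k},$$ for operators $X$ on $(\mathbb C^d)^{\otimes k}$. Let $\overline U(t)$ and $\overline{\mathcal N}_T$ be the same objects with $A$ and $B$ interchanged, $A_n=U(2^n)$, $B_n=\overline U(2^n)$, $\mathcal A_n[X]=A_n^{\otimes k}XA_n^{\dagger\otimes k}$, $\mathcal B_n[X]=B_n^{\otimes k}XB_n^{\dagger\otimes k}$, and $\mathcal N_{\mathrm{Haar}}[X]=\int_{\mathrm{SU}(d)}U^{\otimes k}XU^{\dagger\otimes k}\,dU$ for the Haar probability measure. Let $\|\mathcal N\|_2^2=\sum_{\alpha\beta\gamma\delta}\bigl|\langle\alpha|\mathcal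 N[|\beta\rangle\langle\gamma|]|\delta\rangle\bigr|^2$, summed over an orthonormal basis of $(\mathbb C^d)^{\otimes k}$, and $$M_n=\|\mathcal N_{2^n}-\mathcal N_{\mathrm{Haar}}\|_2^2+\|\overline{\mathcal N}_{2^n}-\mathcal N_{\mathrm{Haar}}\|_2^2 .$$ (1) For all $A,B\in\mathrm{SU}(d)$ and $n\ge0$, $M_{n+1}\le M_n$, with equality if and only if $\mathcal N_{2^{n+1}}=\mathcal N_{2^n}=\overline{\mathcal N}_{2^n}\circ\mathcal A_n$ and $\overline{\mathcal N}_{2^{n+1}}=\overline{\mathcal N}_{2^n}=\mathcal N_{2^n}\circ\mathcal B_n$. (2) Let $K\subset\mathrm{SU}(d)\times\mathrm{SU}(d)$ be a compact set such that every pair in $K$ generates a dense subgroup of $\mathrm{SU}(d)$. Then there are an open set $\Omega\supseteq K$ and $\delta_*>0$ such that, for all $A,B\in\mathrm{SU}(d)$ and $n\ge 0$ with $(A_n,B_n)\in\Omega$, $$M_{n+3}\le(1-\delta_*)M_n .$$ (3) Let $d=2$. For $n\ge1$ write $A_n=\exp(-i\alpha_n\,\hat a_n\cdot\vec\sigma)$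 and $B_n=\exp(-i\alpha_n\,\hat b_n\cdot\vec\sigma)$ with $\vec\sigma$ the vector of Pauli matrices, $\alpha_n\in[0,\pi]$ (the same angle for both, since $\operatorname{tr}A_n=\operatorname{tr}B_n$) and unit vectors $\hat a_n,\hat b_n\in\mathbb R^3$. Let $\hat z$ be the unit vector in the direction of $\hat a_1+\hat b_1$ (defined for almost all $A,B$), and let $c_n=\cos\alpha_n+i\sin\alpha_n\,(\hat a_n\cdot\hat z)$ be the disk coordinate of $(A_n,B_n)$. Then for almost all $(A,B)\in\mathrm{SU}(2)\times\mathrm{SU}(2)$ (with respect to the product of the Haar measures) there are $\varepsilon>0$ and $\delta_*>0$ such that, for every $n\ge1$, $|c_n-c_1|<\varepsilon$ implies $M_{n+3}\le(1-\delta_*)M_n$. -/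

import Mathlib

open MeasureTheory

namespace ThueMorse

/-- The special unitary group `SU(d)`, with the topology inherited from the complex matrices. -/
abbrev SU (d : ℕ) : Type := Matrix.specialUnitaryGroup (Fin d) ℂ

theorem SU.coe_inv {d : ℕ} (U : SU d) :
    ((U⁻¹ : SU d) : Matrix (Fin d) (Fin d) ℂ) = star (U : Matrix (Fin d) (Fin d) ℂ) := rfl

instance SU.instIsTopologicalGroup (d : ℕ) : IsTopologicalGroup (SU d) where
  continuous_mul := continuous_mul
  continuous_inv := by
    refine Continuous.subtype_mk (p := fun x => x ∈ Matrix.specialUnitaryGroup (Fin d) ℂ)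
      (f := fun U : SU d => star (U : Matrix (Fin d) (Fin d) ℂ)) ?_ _
    exact continuous_subtype_val.matrix_conjTranspose

theorem SU.norm_entry_le_one {d : ℕ} (U : SU d) (i j : Fin d) :
    ‖(U : Matrix (Fin d) (Fin d) ℂ) i j‖ ≤ 1 :=
  entry_norm_bound_of_unitary (Matrix.specialUnitaryGroup_le_unitaryGroup U.2) i j

instance SU.instCompactSpace (d : ℕ) : CompactSpace (SU d) := by
  have hK : IsCompact (Set.univ.pi fun _ : Fin d => Set.univ.pi fun _ : Fin d =>
      Metric.closedBall (0 : ℂ) 1) :=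
    isCompact_univ_pi fun _ => isCompact_univ_pi fun _ => isCompact_closedBall 0 1
  have hclosed : IsClosed {A : Matrix (Fin d) (Fin d) ℂ |
      A ∈ Matrix.specialUnitaryGroup (Fin d) ℂ} := by
    have h : {A : Matrix (Fin d) (Fin d) ℂ | A ∈ Matrix.specialUnitaryGroup (Fin d) ℂ}
        = {A | A * star A = 1} ∩ {A | A.det = 1} := by
      ext A
      simp [Matrix.mem_specialUnitaryGroup_iff, Matrix.mem_unitaryGroup_iff]
    rw [h]
    refine IsClosed.inter (isClosed_eq ?_ continuous_const) (isClosed_eq ?_ continuous_const)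
    · exact continuous_id.matrix_mul continuous_id.matrix_conjTranspose
    · exact continuous_id.matrix_det
  refine isCompact_iff_compactSpace.mp (hK.of_isClosed_subset hclosed ?_)
  intro A hA i _ j _
  simpa using SU.norm_entry_le_one (⟨A, hA⟩ : SU d) i j

noncomputable instance SU.instMeasurableSpace (d : ℕ) : MeasurableSpace (SU d) := borel (SU d)

instance SU.instBorelSpace (d : ℕ) : BorelSpace (SU d) := ⟨rfl⟩

/-- The Haar probability measure of `SU(d)`: the Haar measure giving the whole group mass `1`. -/
noncomputable def SU.haar (d : ℕ) : Measure (SU d) := Measure.haarMeasure ⊤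

instance SU.instIsProbabilityMeasure (d : ℕ) : IsProbabilityMeasure (SU.haar d) :=
  ⟨by
    have h := Measure.haarMeasure_self (K₀ := (⊤ : TopologicalSpace.PositiveCompacts (SU d)))
    rwa [TopologicalSpace.PositiveCompacts.coe_top] at h⟩

/-- The pair `(A, B)` generates `SU(d)` (as a topological group): the subgroup generated by `A`
and `B` is dense. -/
def Generates {d : ℕ} (A B : SU d) : Prop :=
  (Subgroup.closure {A, B}).topologicalClosure = ⊤

/-- Operators on the replicated space `(ℂ^d)^{⊗ k}`, written as matrices in the orthonormal product
basis, which is labelled by the functions `Fin k → Fin d`. -/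
abbrev ReplicatedOp (d k : ℕ) : Type := Matrix (Fin k → Fin d) (Fin k → Fin d) ℂ

/-- Superoperators on the replicated space. -/
abbrev Superop (d k : ℕ) : Type := ReplicatedOp d k →ₗ[ℂ] ReplicatedOp d k

/-- The tensor power `U^{⊗ k}`. -/
def tensorPow {d : ℕ} (k : ℕ) (U : Matrix (Fin d) (Fin d) ℂ) : ReplicatedOp d k :=
  Matrix.of fun α β => ∏ i, U (α i) (β i)

/-- The unitary channel `X ↦ U^{⊗ k} X U^{† ⊗ k}`. -/
def unitaryChannel {d : ℕ} (k : ℕ) (U : SU d) : Superop d k where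
  toFun X := tensorPow k (U : Matrix (Fin d) (Fin d) ℂ) * X *
    tensorPow k (star (U : Matrix (Fin d) (Fin d) ℂ))
  map_add' X Y := by rw [Matrix.mul_add, Matrix.add_mul]
  map_smul' c X := by simp

theorem continuous_unitaryChannel_apply (d k : ℕ) (X : ReplicatedOp d k) (α δ : Fin k → Fin d) :
    Continuous fun U : SU d => unitaryChannel k U X α δ := by
  have h : ∀ i j, Continuous fun U : SU d => (U : Matrix (Fin d) (Fin d) ℂ) i j := fun i j =>
    continuous_subtype_val.matrix_elem i j
  have h' : ∀ i j, Continuous fun U : SU d => star ((U : Matrix (Fin d) (Fin d) ℂ) i j) :=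
    fun i j => (h i j).star
  simp only [unitaryChannel, LinearMap.coe_mk, AddHom.coe_mk, Matrix.mul_apply, tensorPow,
    Matrix.of_apply, Matrix.star_apply]
  refine continuous_finsetSum _ fun j _ => Continuous.mul ?_ ?_
  · exact continuous_finsetSum _ fun i _ =>
      (continuous_finsetProd _ fun l _ => h _ _).mul continuous_const
  · exact continuous_finsetProd _ fun l _ => h' _ _

theorem integrable_unitaryChannel_apply (d k : ℕ) (X : ReplicatedOp d k) (α δ : Fin k → Fin d) :
    Integrable (fun U : SU d => unitaryChannel k U X α δ) (SU.haar d) :=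
  (continuous_unitaryChannel_apply d k X α δ).integrable_of_hasCompactSupport
    (HasCompactSupport.of_compactSpace _)

/-- The Haar-averaging channel `X ↦ ∫ U^{⊗ k} X U^{† ⊗ k} dU`, with the matrix-valued integral
taken entry by entry. -/
noncomputable def haarChannel (d k : ℕ) : Superop d k where
  toFun X := Matrix.of fun α δ => ∫ U : SU d, unitaryChannel k U X α δ ∂(SU.haar d)
  map_add' X Y := by
    ext α δ
    simp only [map_add, Matrix.add_apply, Matrix.of_apply]
    exact integral_add (integrable_unitaryChannel_apply d k X α δ)
      (integrable_unitaryChannel_apply d k Y α δ)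
  map_smul' c X := by
    ext α δ
    simp only [map_smul, Matrix.smul_apply, Matrix.of_apply, RingHom.id_apply]
    exact integral_smul c _

/-- The Hilbert–Schmidt norm of a superoperator,
`‖N‖₂ = sqrt (∑_{αβγδ} |⟨α| N[|β⟩⟨γ|] |δ⟩|²)`. -/
noncomputable def hsNorm {d k : ℕ} (N : Superop d k) : ℝ :=
  Real.sqrt (∑ α, ∑ β, ∑ γ, ∑ δ, ‖N (Matrix.single β γ 1) α δ‖ ^ 2)

/-- The finite Thue–Morse words: `W₀ = 0`, and `W_{n+1}` is `W_n` followed by its bitwise negation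
(`false` is the letter `0`, `true` is the letter `1`). -/
def word : ℕ → List Bool
  | 0 => [false]
  | n + 1 => word n ++ (word n).map not

theorem length_word (n : ℕ) : (word n).length = 2 ^ n := by
  induction n with
  | zero => rfl
  | succ n ih => simp [word, ih, pow_succ, mul_two]

/-- The infinite Thue–Morse word, with letters indexed from `0`. -/
def letter (j : ℕ) : Bool := (word j).getD j false

/-- The infinite word extends every finite word. -/
theorem word_getD (n j : ℕ) (h : j < 2 ^ n) : (word n).getD j false = letter j := by
  have step : ∀ m p, j < 2 ^ m → (word (m + p)).getD j false = (word m).getD j false := by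
    intro m p hm
    induction p with
    | zero => rfl
    | succ p ih =>
      have : j < (word (m + p)).length := by
        rw [length_word]
        exact hm.trans_le (Nat.pow_le_pow_right (by norm_num) (Nat.le_add_right m p))
      rw [← ih, ← Nat.add_assoc, word, List.getD_append _ _ _ _ this]
  rw [letter, ← step n j h, ← step j n Nat.lt_two_pow_self, Nat.add_comm]

/-- The evolution operator `U(t)` of the drive: the time-ordered product of the first `t` driving
unitaries (later ones on the left), the letter `0` standing for `A` and the letter `1` for `B`. -/
def evolution {d : ℕ} (A B : SU d) : ℕ → SU d
  | 0 => 1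
  | t + 1 => (if letter t then B else A) * evolution A B t

/-- The time-averaging channel `𝒩_T[·] = T⁻¹ ∑_{t < T} U(t)^{⊗ k} [·] U(t)^{† ⊗ k}`. -/
noncomputable def timeAverage {d : ℕ} (k : ℕ) (A B : SU d) (T : ℕ) : Superop d k :=
  (T : ℂ)⁻¹ • ∑ t ∈ Finset.range T, unitaryChannel k (evolution A B t)

/-- The time-averaging channel of the drive in which `A` and `B` are interchanged. -/
noncomputable def timeAverageBar {d : ℕ} (k : ℕ) (A B : SU d) (T : ℕ) : Superop d k :=
  timeAverage k B A T

/-- `A_n = U(2^n)`. -/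
def unitaryA {d : ℕ} (A B : SU d) (n : ℕ) : SU d := evolution A B (2 ^ n)

/-- `B_n` is `U(2^n)` for the drive in which `A` and `B` are interchanged. -/
def unitaryB {d : ℕ} (A B : SU d) (n : ℕ) : SU d := evolution B A (2 ^ n)

/-- `M_n = ‖𝒩_{2^n} - 𝒩_Haar‖₂² + ‖𝒩bar_{2^n} - 𝒩_Haar‖₂²`. -/
noncomputable def monotone {d : ℕ} (k : ℕ) (A B : SU d) (n : ℕ) : ℝ :=
  hsNorm (timeAverage k A B (2 ^ n) - haarChannel d k) ^ 2 +
    hsNorm (timeAverageBar k A B (2 ^ n) - haarChannel d k) ^ 2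

/-- The three Pauli matrices. -/
def pauli : Fin 3 → Matrix (Fin 2) (Fin 2) ℂ :=
  ![!![0, 1; 1, 0], !![0, -Complex.I; Complex.I, 0], !![1, 0; 0, -1]]

/-- `v · σ` for a real vector `v`. -/
noncomputable def pauliDot (v : EuclideanSpace ℝ (Fin 3)) : Matrix (Fin 2) (Fin 2) ℂ :=
  ∑ j, (v j : ℂ) • pauli j

/-- For `U = exp(-i α u·σ)` with a unit vector `u`, this is `cos α`. -/
noncomputable def cosAngle (U : Matrix (Fin 2) (Fin 2) ℂ) : ℝ := (U.trace / 2).re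

/-- For `U = exp(-i α u·σ)` with a unit vector `u`, this is the vector `sin α u`. -/
noncomputable def sinAxis (U : Matrix (Fin 2) (Fin 2) ℂ) : EuclideanSpace ℝ (Fin 3) :=
  WithLp.toLp 2 fun j => (Complex.I * (pauli j * U).trace / 2).re

theorem pauliDot_mul_self (u : EuclideanSpace ℝ (Fin 3)) (hu : ‖u‖ = 1) :
    pauliDot u * pauliDot u = 1 := by
  have h : u 0 ^ 2 + u 1 ^ 2 + u 2 ^ 2 = 1 := by
    have := EuclideanSpace.real_norm_sq_eq u
    rw [hu, Fin.sum_univ_three] at this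
    linarith
  have hc : (u 0 : ℂ) ^ 2 + (u 1 : ℂ) ^ 2 + (u 2 : ℂ) ^ 2 = 1 := by
    rw [← Complex.ofReal_pow, ← Complex.ofReal_pow, ← Complex.ofReal_pow, ← Complex.ofReal_add,
      ← Complex.ofReal_add, h, Complex.ofReal_one]
  ext i j
  fin_cases i <;> fin_cases j <;>
    simp [pauliDot, pauli, Fin.sum_univ_three, Matrix.mul_apply, Fin.sum_univ_two] <;>
    ring_nf <;> simp <;> linear_combination hc

/-- Euler's formula `exp(-i α u·σ) = cos α - i sin α u·σ` for a unit vector `u`. -/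
theorem exp_pauliDot (t : ℝ) (u : EuclideanSpace ℝ (Fin 3)) (hu : ‖u‖ = 1) :
    NormedSpace.exp (-(Complex.I * (t : ℂ)) • pauliDot u) =
      (Real.cos t : ℂ) • (1 : Matrix (Fin 2) (Fin 2) ℂ) -
        (Complex.I * (Real.sin t : ℂ)) • pauliDot u := by
  have hX := pauliDot_mul_self u hu
  set X := pauliDot u
  set z : ℂ := -(Complex.I * (t : ℂ)) with hz
  have hpow : ∀ n : ℕ, X ^ n = (1 / 2 : ℂ) • (1 + X) + ((-1) ^ n / 2 : ℂ) • (1 - X) := by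
    intro n
    induction n with
    | zero =>
      rw [pow_zero, pow_zero]
      module
    | succ n ih =>
      rw [pow_succ, ih, Matrix.add_mul, Matrix.smul_mul, Matrix.smul_mul, Matrix.add_mul,
        Matrix.sub_mul, hX, Matrix.one_mul, pow_succ]
      module
  have hs : ∀ w : ℂ, HasSum (fun n : ℕ => w ^ n / (n.factorial : ℂ)) (Complex.exp w) := by
    intro w
    rw [Complex.exp_eq_exp_ℂ]
    exact NormedSpace.expSeries_div_hasSum_exp w
  have h1 := (hs z).smul_const ((1 / 2 : ℂ) • (1 + X))
  have h2 := (hs (-z)).smul_const ((1 / 2 : ℂ) • (1 - X))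
  have h3 : HasSum (fun n : ℕ => ((n.factorial : ℂ))⁻¹ • (z • X) ^ n)
      (Complex.exp z • ((1 / 2 : ℂ) • (1 + X)) + Complex.exp (-z) • ((1 / 2 : ℂ) • (1 - X))) := by
    convert h1.add h2 using 2 with n
    rw [smul_pow, hpow, neg_pow z]
    module
  rw [NormedSpace.exp_eq_tsum ℂ]
  refine h3.tsum_eq.trans ?_
  have e1 : Complex.exp z = (Real.cos t : ℂ) - Complex.I * (Real.sin t : ℂ) := by
    rw [hz, show -(Complex.I * (t : ℂ)) = -(t : ℂ) * Complex.I by ring, Complex.exp_mul_I,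
      Complex.cos_neg, Complex.sin_neg]
    push_cast
    ring
  have e2 : Complex.exp (-z) = (Real.cos t : ℂ) + Complex.I * (Real.sin t : ℂ) := by
    rw [hz, show -(-(Complex.I * (t : ℂ))) = (t : ℂ) * Complex.I by ring, Complex.exp_mul_I]
    push_cast
    ring
  rw [e1, e2]
  module

/-- `cosAngle` and `sinAxis` read off the rotation angle and axis of `exp(-i α u·σ)`. -/
theorem cosAngle_sinAxis_exp (t : ℝ) (u : EuclideanSpace ℝ (Fin 3)) (hu : ‖u‖ = 1) :
    cosAngle (NormedSpace.exp (-(Complex.I * (t : ℂ)) • pauliDot u)) = Real.cos t ∧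
      sinAxis (NormedSpace.exp (-(Complex.I * (t : ℂ)) • pauliDot u)) = Real.sin t • u := by
  rw [exp_pauliDot t u hu]
  have hre : (Complex.cos (t : ℂ)).re = Real.cos t := Complex.cos_ofReal_re t
  have hsre : (Complex.sin (t : ℂ)).re = Real.sin t := Complex.sin_ofReal_re t
  constructor
  · simp [cosAngle, pauliDot, pauli, Fin.sum_univ_three, Matrix.trace, Fin.sum_univ_two, hre]
  · ext j
    fin_cases j <;>
      simp [sinAxis, pauliDot, pauli, Fin.sum_univ_three, Matrix.trace, Fin.sum_univ_two,
        Matrix.one_fin_two, Matrix.mul_apply, hsre]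

/-- The unit vector in the direction of `a₁ + b₁`, the sum of the rotation axes of `A₁` and `B₁`
(which have the same rotation angle). The line of `a_n + b_n` is the same for all `n ≥ 1`. -/
noncomputable def diskAxis (A B : SU 2) : EuclideanSpace ℝ (Fin 3) :=
  let s := sinAxis (unitaryA A B 1 : Matrix (Fin 2) (Fin 2) ℂ) +
    sinAxis (unitaryB A B 1 : Matrix (Fin 2) (Fin 2) ℂ)
  ‖s‖⁻¹ • s

/-- The disk coordinate `c_n = cos α_n + i sin α_n a_n^Z` of `(A_n, B_n)`, `n ≥ 1`, where
`A_n = exp(-i α_n a_n·σ)` and `a_n^Z` is the component of `a_n` along `diskAxis A B`. -/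
noncomputable def diskCoord (A B : SU 2) (n : ℕ) : ℂ :=
  (cosAngle (unitaryA A B n : Matrix (Fin 2) (Fin 2) ℂ) : ℂ) + Complex.I *
    ((inner ℝ (sinAxis (unitaryA A B n : Matrix (Fin 2) (Fin 2) ℂ)) (diskAxis A B) : ℝ) : ℂ)

end ThueMorse

/-! In the basis of matrix units superoperators are matrices, the Hilbert–Schmidt norm is the
Frobenius norm, the unitary channels form a unitary representation `ρ` of `SU(d)`, and the Haar
channel is a projection `P` with `ρ(g) P = P = P ρ(g)`. The second half of a Thue–Morse word is the
negation of the first, so the deviations `X`, `Y` of the two time averages from `P` evolve by `X ↦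
(X + Y ρ(A_n))/2`, `Y ↦ (Y + X ρ(B_n))/2`. By the parallelogram law this step lowers `‖X‖² + ‖Y‖²`
by exactly `(‖X - Y ρ(A_n)‖² + ‖Y - X ρ(B_n)‖²)/4`, which gives monotonicity and its equality case
(`frobSq_avgStep_add`).

Equality in two successive steps forces `X = Y` to be invariant under `A_n` and `B_n`
(`invariant_of_energyTwo_eq`). If these generate a dense subgroup, then `X = X P`, while deviations
satisfy `X P = 0`; hence `X = 0`. Compactness of the unit sphere and of `K`, together with the tube
lemma, turns this strict decrease into a uniform factor near `K` (`exists_energyTwo_le`).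

For one qubit, two non-commuting elements with a common angle that is not a rational multiple of `π`
generate: the closure of the subgroup contains a maximal torus and an element outside its
normaliser. The coordinate `c_n` fixes the angle and the sum of the axes, hence also whether the
pair commutes. Every pair with the data of `(A_1, B_1)` therefore generates, and the compact fibre
of such pairs serves as `K`. The exceptional pairs are null because suitable translations by
`e^{in}` bring almost every point into the bad set only finitely often. -/

namespace ThueMorse

/-! ### The squared Frobenius norm -/

/-- The squared Frobenius norm of a complex matrix. -/
noncomputable def frobSq {I J : Type*} [Fintype I] [Fintype J] (M : Matrix I J ℂ) : ℝ :=
  ∑ i, ∑ j, ‖M i j‖ ^ 2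

section Frobenius

variable {I J : Type*} [Fintype I] [Fintype J]

theorem frobSq_nonneg (M : Matrix I J ℂ) : 0 ≤ frobSq M :=
  Finset.sum_nonneg fun _ _ => Finset.sum_nonneg fun _ _ => by positivity

theorem norm_sq_le_frobSq (M : Matrix I J ℂ) (i : I) (j : J) : ‖M i j‖ ^ 2 ≤ frobSq M :=
  (Finset.single_le_sum (f := fun j => ‖M i j‖ ^ 2) (fun _ _ => by positivity)
    (Finset.mem_univ j)).trans
  (Finset.single_le_sum (f := fun i => ∑ j, ‖M i j‖ ^ 2)
    (fun _ _ => Finset.sum_nonneg fun _ _ => by positivity) (Finset.mem_univ i))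

theorem frobSq_eq_zero {M : Matrix I J ℂ} : frobSq M = 0 ↔ M = 0 := by
  constructor
  · intro h
    ext i j
    have := norm_sq_le_frobSq M i j
    rw [h] at this
    simpa using this
  · rintro rfl
    simp [frobSq]

theorem frobSq_smul (c : ℂ) (M : Matrix I J ℂ) : frobSq (c • M) = ‖c‖ ^ 2 * frobSq M := by
  simp [frobSq, mul_pow, Finset.mul_sum]

theorem frobSq_add_add_frobSq_sub (X Y : Matrix I J ℂ) :
    frobSq (X + Y) + frobSq (X - Y) = 2 * (frobSq X + frobSq Y) := by
  simp only [frobSq, ← Finset.sum_add_distrib, Finset.mul_sum]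
  refine Finset.sum_congr rfl fun i _ => Finset.sum_congr rfl fun j _ => ?_
  have := parallelogram_law_with_norm ℂ (X i j) (Y i j)
  simp only [Matrix.add_apply, Matrix.sub_apply]
  linarith

theorem frobSq_eq_trace (M : Matrix I J ℂ) : (frobSq M : ℂ) = (M * M.conjTranspose).trace := by
  simp [frobSq, Matrix.trace, Matrix.mul_apply, Matrix.conjTranspose_apply, Complex.mul_conj,
    Complex.normSq_eq_norm_sq]

theorem frobSq_mul_of_mul_star [DecidableEq J] (M : Matrix I J ℂ) {U : Matrix J J ℂ}
    (hU : U * star U = 1) : frobSq (M * U) = frobSq M := by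
  have h : (frobSq (M * U) : ℂ) = frobSq M := by
    rw [Matrix.star_eq_conjTranspose] at hU
    rw [frobSq_eq_trace, frobSq_eq_trace, Matrix.conjTranspose_mul, Matrix.mul_assoc,
      ← Matrix.mul_assoc U, hU, Matrix.one_mul]
  exact_mod_cast h

theorem continuous_frobSq : Continuous (frobSq : Matrix I J ℂ → ℝ) :=
  continuous_finsetSum _ fun i _ => continuous_finsetSum _ fun j _ =>
    ((continuous_id.matrix_elem i j).norm).pow 2

/-- The sphere over which the two-step energy is maximised; each entry of a unit pair lies in the
closed unit disc. -/
theorem isCompact_unit_pairs {J : Type*} [Fintype J] (P : Matrix J J ℂ) :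
    IsCompact {q : Matrix J J ℂ × Matrix J J ℂ |
      frobSq q.1 + frobSq q.2 = 1 ∧ q.1 * P = 0 ∧ q.2 * P = 0} := by
  have hball : IsCompact (Set.univ.pi fun _ : J => Set.univ.pi fun _ : J =>
      Metric.closedBall (0 : ℂ) 1) :=
    isCompact_univ_pi fun _ => isCompact_univ_pi fun _ => isCompact_closedBall 0 1
  refine (hball.prod hball).of_isClosed_subset ?_ ?_
  · refine IsClosed.inter (isClosed_eq ((continuous_frobSq.comp continuous_fst).add
      (continuous_frobSq.comp continuous_snd)) continuous_const) (IsClosed.inter ?_ ?_)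
    · exact isClosed_eq (continuous_fst.matrix_mul continuous_const) continuous_const
    · exact isClosed_eq (continuous_snd.matrix_mul continuous_const) continuous_const
  · rintro ⟨X, Y⟩ ⟨h, -, -⟩
    simp only at h
    have hX := frobSq_nonneg X
    have hY := frobSq_nonneg Y
    refine ⟨fun i _ j _ => ?_, fun i _ j _ => ?_⟩
    · have := norm_sq_le_frobSq X i j
      rw [mem_closedBall_zero_iff]
      exact (sq_le_one_iff₀ (norm_nonneg _)).1 (by linarith)
    · have := norm_sq_le_frobSq Y i j
      rw [mem_closedBall_zero_iff]
      exact (sq_le_one_iff₀ (norm_nonneg _)).1 (by linarith)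

end Frobenius

/-! ### The averaging step -/

section Step

variable {G J : Type*} [Group G] [Fintype J] [DecidableEq J] (ρ : G →* Matrix J J ℂ)

/-- The average of `X` and `Y ρ(g)`. -/
noncomputable def avgStep (g : G) (X Y : Matrix J J ℂ) : Matrix J J ℂ :=
  (2⁻¹ : ℂ) • (X + Y * ρ g)

variable {ρ}

/-- The parallelogram law for `X, Y ρ(a)` and for `Y, X ρ(b)`, where unitarity removes `ρ` from the
single norms; the `4` is the square of the averaging factor. -/
theorem frobSq_avgStep_add (hρ : ∀ g, ρ g * star (ρ g) = 1) (a b : G) (X Y : Matrix J J ℂ) :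
    frobSq (avgStep ρ a X Y) + frobSq (avgStep ρ b Y X) =
      frobSq X + frobSq Y - (frobSq (X - Y * ρ a) + frobSq (Y - X * ρ b)) / 4 := by
  have h1 := frobSq_add_add_frobSq_sub X (Y * ρ a)
  have h2 := frobSq_add_add_frobSq_sub Y (X * ρ b)
  rw [frobSq_mul_of_mul_star _ (hρ a)] at h1
  rw [frobSq_mul_of_mul_star _ (hρ b)] at h2
  rw [avgStep, avgStep, frobSq_smul, frobSq_smul]
  norm_num
  linarith

theorem frobSq_avgStep_add_le (hρ : ∀ g, ρ g * star (ρ g) = 1) (a b : G) (X Y : Matrix J J ℂ) :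
    frobSq (avgStep ρ a X Y) + frobSq (avgStep ρ b Y X) ≤ frobSq X + frobSq Y := by
  rw [frobSq_avgStep_add hρ]
  linarith [frobSq_nonneg (X - Y * ρ a), frobSq_nonneg (Y - X * ρ b)]

theorem frobSq_avgStep_add_eq_iff (hρ : ∀ g, ρ g * star (ρ g) = 1) (a b : G)
    (X Y : Matrix J J ℂ) :
    frobSq (avgStep ρ a X Y) + frobSq (avgStep ρ b Y X) = frobSq X + frobSq Y ↔
      X = Y * ρ a ∧ Y = X * ρ b := by
  rw [frobSq_avgStep_add hρ, ← sub_eq_zero (a := X), ← sub_eq_zero (a := Y), ← frobSq_eq_zero,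
    ← frobSq_eq_zero]
  have h1 := frobSq_nonneg (X - Y * ρ a)
  have h2 := frobSq_nonneg (Y - X * ρ b)
  constructor
  · intro h
    constructor <;> linarith
  · rintro ⟨h3, h4⟩
    rw [h3, h4]
    ring

theorem avgStep_of_eq {g : G} {X Y : Matrix J J ℂ} (h : X = Y * ρ g) : avgStep ρ g X Y = X := by
  rw [avgStep, ← h, ← two_smul ℂ X, smul_smul]
  norm_num

variable (ρ) in
/-- The sum of the squared norms after two averaging steps. -/
noncomputable def energyTwo (a b : G) (X Y : Matrix J J ℂ) : ℝ :=
  frobSq (avgStep ρ (b * a) (avgStep ρ a X Y) (avgStep ρ b Y X)) +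
    frobSq (avgStep ρ (a * b) (avgStep ρ b Y X) (avgStep ρ a X Y))

theorem energyTwo_le (hρ : ∀ g, ρ g * star (ρ g) = 1) (a b : G) (X Y : Matrix J J ℂ) :
    energyTwo ρ a b X Y ≤ frobSq X + frobSq Y :=
  (frobSq_avgStep_add_le hρ _ _ _ _).trans (frobSq_avgStep_add_le hρ _ _ _ _)

/-- Equality in two successive averaging steps forces invariance under both unitaries. -/
theorem invariant_of_energyTwo_eq (hρ : ∀ g, ρ g * star (ρ g) = 1) {a b : G}
    {X Y : Matrix J J ℂ} (h : energyTwo ρ a b X Y = frobSq X + frobSq Y) :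
    X = Y ∧ X * ρ a = X ∧ X * ρ b = X := by
  have h1 := frobSq_avgStep_add_le hρ (b * a) (a * b) (avgStep ρ a X Y) (avgStep ρ b Y X)
  have h2 := frobSq_avgStep_add_le hρ a b X Y
  rw [energyTwo] at h
  obtain ⟨hX, hY⟩ := (frobSq_avgStep_add_eq_iff hρ a b X Y).1 (by linarith)
  have h3 := (frobSq_avgStep_add_eq_iff hρ (b * a) (a * b) (avgStep ρ a X Y)
    (avgStep ρ b Y X)).1 (by linarith)
  rw [avgStep_of_eq hX, avgStep_of_eq hY, map_mul, ← Matrix.mul_assoc] at h3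
  -- The first step gives `X = Y ρ(a)`, the second `X = Y ρ(b) ρ(a)`; cancelling `ρ(a)` leaves `Y`
  -- fixed by `ρ(b)`.
  have h4 : Y * ρ b * ρ a = Y * ρ a := by rw [← h3.1, ← hX]
  have h5 : Y * ρ b = Y := by
    have := congrArg (fun M => M * star (ρ a)) h4
    simpa only [Matrix.mul_assoc, hρ, Matrix.mul_one] using this
  -- Both `X ρ(b)` and `Y ρ(b)` equal `Y`, and `ρ(b)` is invertible.
  have h6 : X = Y := by
    have : X * ρ b = Y * ρ b := by rw [h5, ← hY]
    have := congrArg (fun M => M * star (ρ b)) this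
    simpa only [Matrix.mul_assoc, hρ, Matrix.mul_one] using this
  refine ⟨h6, ?_, ?_⟩
  · nth_rewrite 1 [h6]
    exact hX.symm
  · rw [← hY, h6]

theorem avgStep_smul (g : G) (c : ℂ) (X Y : Matrix J J ℂ) :
    avgStep ρ g (c • X) (c • Y) = c • avgStep ρ g X Y := by
  rw [avgStep, avgStep, Matrix.smul_mul, ← smul_add, smul_comm]

theorem energyTwo_smul (a b : G) (c : ℂ) (X Y : Matrix J J ℂ) :
    energyTwo ρ a b (c • X) (c • Y) = ‖c‖ ^ 2 * energyTwo ρ a b X Y := by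
  simp only [energyTwo, avgStep_smul, frobSq_smul, mul_add]

variable [TopologicalSpace G] [IsTopologicalGroup G]

/-- By continuity the stabiliser of `X` is a closed subgroup, so it contains the closure of any
subgroup it contains. -/
theorem invariant_of_dense (hc : Continuous ρ) {a b : G}
    (hab : (Subgroup.closure {a, b}).topologicalClosure = ⊤) {X : Matrix J J ℂ}
    (ha : X * ρ a = X) (hb : X * ρ b = X) (g : G) : X * ρ g = X := by
  let S : Subgroup G :=
    { carrier := {g | X * ρ g = X}
      mul_mem' := fun {g h} hg hh => by
        simp only [Set.mem_ofPred_eq] at *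
        rw [map_mul, ← Matrix.mul_assoc, hg, hh]
      one_mem' := by simp
      inv_mem' := fun {g} hg => by
        simp only [Set.mem_ofPred_eq] at *
        nth_rewrite 1 [← hg]
        rw [Matrix.mul_assoc, ← map_mul, mul_inv_cancel, map_one, Matrix.mul_one] }
  have hcl : IsClosed (S : Set G) := isClosed_eq (continuous_const.matrix_mul hc) continuous_const
  have hle : Subgroup.closure {a, b} ≤ S := by
    rw [Subgroup.closure_le]
    rintro x (rfl | rfl)
    exacts [ha, hb]
  have : g ∈ (Subgroup.closure {a, b}).topologicalClosure := by
    rw [hab]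
    trivial
  exact Subgroup.topologicalClosure_minimal _ hle hcl this

theorem continuous_energyTwo (hc : Continuous ρ) :
    Continuous fun q : (G × G) × (Matrix J J ℂ × Matrix J J ℂ) =>
      energyTwo ρ q.1.1 q.1.2 q.2.1 q.2.2 := by
  have hstep : ∀ {T : Type _} [TopologicalSpace T] {g : T → G} {X Y : T → Matrix J J ℂ},
      Continuous g → Continuous X → Continuous Y →
      Continuous fun t => avgStep ρ (g t) (X t) (Y t) := by
    intro T _ g X Y hg hX hY
    exact (hX.add (hY.matrix_mul (hc.comp hg))).const_smul (2⁻¹ : ℂ)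
  have ha : Continuous fun q : (G × G) × (Matrix J J ℂ × Matrix J J ℂ) => q.1.1 := by fun_prop
  have hb : Continuous fun q : (G × G) × (Matrix J J ℂ × Matrix J J ℂ) => q.1.2 := by fun_prop
  have hX : Continuous fun q : (G × G) × (Matrix J J ℂ × Matrix J J ℂ) => q.2.1 := by fun_prop
  have hY : Continuous fun q : (G × G) × (Matrix J J ℂ × Matrix J J ℂ) => q.2.2 := by fun_prop
  have h1 := hstep ha hX hY
  have h2 := hstep hb hY hX
  exact (continuous_frobSq.comp (hstep (hb.mul ha) h1 h2)).add
    (continuous_frobSq.comp (hstep (ha.mul hb) h2 h1))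

/-- Uniform contraction of two averaging steps, near a compact set of generating pairs, on the
matrices annihilated by the projection `P` onto the invariants. -/
theorem exists_energyTwo_le (hρ : ∀ g, ρ g * star (ρ g) = 1) (hc : Continuous ρ)
    (P : Matrix J J ℂ) (hP : ∀ X : Matrix J J ℂ, (∀ g, X * ρ g = X) → X * P = X)
    {K : Set (G × G)} (hK : IsCompact K)
    (hgen : ∀ p ∈ K, (Subgroup.closure {p.1, p.2}).topologicalClosure = ⊤) :
    ∃ Ω : Set (G × G), IsOpen Ω ∧ K ⊆ Ω ∧ ∃ δ : ℝ, 0 < δ ∧ ∀ (a b : G) (X Y : Matrix J J ℂ),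
      (a, b) ∈ Ω → X * P = 0 → Y * P = 0 →
        energyTwo ρ a b X Y ≤ (1 - δ) * (frobSq X + frobSq Y) := by
  set S := {q : Matrix J J ℂ × Matrix J J ℂ |
      frobSq q.1 + frobSq q.2 = 1 ∧ q.1 * P = 0 ∧ q.2 * P = 0} with hS
  have hScomp : IsCompact S := isCompact_unit_pairs P
  have hcont := continuous_energyTwo hc
  -- Equality would make `X = Y` invariant under the whole group, so `X = X P = 0`, against the unit
  -- norm.
  have hlt : ∀ q ∈ K ×ˢ S, energyTwo ρ q.1.1 q.1.2 q.2.1 q.2.2 < 1 := by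
    rintro ⟨⟨a, b⟩, X, Y⟩ ⟨hp, h1, hX, hY⟩
    simp only at h1 hX hY hp ⊢
    refine lt_of_le_of_ne ((energyTwo_le hρ a b X Y).trans h1.le) fun h => ?_
    obtain ⟨hXY, ha, hb⟩ := invariant_of_energyTwo_eq hρ (h.trans h1.symm)
    have h0 : X = 0 := by
      rw [← hX, hP X (invariant_of_dense hc (hgen _ hp) ha hb)]
    rw [← hXY, h0, frobSq_eq_zero.2 rfl] at h1
    norm_num at h1
  -- A level strictly between the maximum and `1` makes the condition open, as the tube lemma
  -- requires.
  obtain ⟨c, hc1, hcK⟩ : ∃ c < (1 : ℝ), ∀ q ∈ K ×ˢ S,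
      energyTwo ρ q.1.1 q.1.2 q.2.1 q.2.2 < c := by
    rcases (K ×ˢ S).eq_empty_or_nonempty with h | h
    · exact ⟨0, one_pos, by simp [h]⟩
    · obtain ⟨q, hq, hmax⟩ := (hK.prod hScomp).exists_isMaxOn h hcont.continuousOn
      obtain ⟨c, hc1, hc2⟩ := exists_between (hlt q hq)
      exact ⟨c, hc2, fun r hr => (hmax hr).trans_lt hc1⟩
  obtain ⟨u, v, hu, -, hKu, hSv, huv⟩ := generalized_tube_lemma hK hScomp
    (isOpen_lt hcont continuous_const) (n := {q | energyTwo ρ q.1.1 q.1.2 q.2.1 q.2.2 < c}) hcK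
  refine ⟨u, hu, hKu, 1 - c, by linarith, fun a b X Y hab hX hY => ?_⟩
  set m := frobSq X + frobSq Y with hm
  have hX0 := frobSq_nonneg X
  have hY0 := frobSq_nonneg Y
  rcases (add_nonneg hX0 hY0).eq_or_lt with h0 | hpos
  · have := energyTwo_le hρ a b X Y
    rw [← hm] at h0
    rw [← hm, ← h0] at this
    rw [← h0]
    linarith
  · rw [← hm] at hpos
    set s : ℝ := Real.sqrt m with hs
    have hs2 : s ^ 2 = m := Real.sq_sqrt hpos.le
    -- The energy is homogeneous of degree two, so dividing by `√m` reduces to the unit sphere.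
    have hsn : ‖((s : ℂ)⁻¹)‖ ^ 2 = m⁻¹ := by
      rw [norm_inv, Complex.norm_real, Real.norm_eq_abs, inv_pow, sq_abs, hs2]
    have hmem : ((s : ℂ)⁻¹ • X, (s : ℂ)⁻¹ • Y) ∈ S := by
      refine ⟨?_, ?_, ?_⟩
      · simp only [frobSq_smul, hsn]
        rw [← mul_add, ← hm, inv_mul_cancel₀ hpos.ne']
      · simp [hX]
      · simp [hY]
    have h := huv (Set.mk_mem_prod hab (hSv hmem))
    simp only [Set.mem_ofPred_eq, energyTwo_smul, hsn] at h
    rw [inv_mul_lt_iff₀ hpos] at h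
    linarith

end Step

/-! ### The matrix of a superoperator -/

section Superoperators

variable {d k : ℕ}

/-- The matrix of a superoperator in the basis of matrix units. -/
noncomputable def superMatrix (N : Superop d k) :
    Matrix ((Fin k → Fin d) × (Fin k → Fin d)) ((Fin k → Fin d) × (Fin k → Fin d)) ℂ :=
  LinearMap.toMatrix (Matrix.stdBasis ℂ _ _) (Matrix.stdBasis ℂ _ _) N

theorem stdBasis_repr {I J : Type*} [Fintype I] [Fintype J] [DecidableEq I] [DecidableEq J]
    (M : Matrix I J ℂ) (i : I) (j : J) : (Matrix.stdBasis ℂ I J).repr M (i, j) = M i j := by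
  simp [Matrix.stdBasis]

theorem superMatrix_apply (N : Superop d k) (α β γ δ : Fin k → Fin d) :
    superMatrix N (α, δ) (β, γ) = N (Matrix.single β γ 1) α δ := by
  rw [superMatrix, LinearMap.toMatrix_apply, stdBasis_repr, Matrix.stdBasis_eq_single]

theorem superMatrix_comp (N N' : Superop d k) :
    superMatrix (N ∘ₗ N') = superMatrix N * superMatrix N' :=
  LinearMap.toMatrix_comp _ _ _ _ _

theorem superMatrix_injective : Function.Injective (superMatrix : Superop d k → _) :=
  (LinearMap.toMatrix _ _).injective

theorem superMatrix_add (N N' : Superop d k) :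
    superMatrix (N + N') = superMatrix N + superMatrix N' := map_add _ _ _

theorem superMatrix_sub (N N' : Superop d k) :
    superMatrix (N - N') = superMatrix N - superMatrix N' := map_sub _ _ _

theorem superMatrix_smul (c : ℂ) (N : Superop d k) :
    superMatrix (c • N) = c • superMatrix N := map_smul _ _ _

theorem hsNorm_sq (N : Superop d k) : hsNorm N ^ 2 = frobSq (superMatrix N) := by
  rw [hsNorm, Real.sq_sqrt (by positivity), frobSq, Fintype.sum_prod_type]
  refine Finset.sum_congr rfl fun α _ => ?_
  simp only [Fintype.sum_prod_type, superMatrix_apply]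
  conv_rhs => rw [Finset.sum_comm]
  exact Finset.sum_congr rfl fun β _ => Finset.sum_comm

/-! ### The unitary channels -/

theorem tensorPow_mul (U V : Matrix (Fin d) (Fin d) ℂ) :
    tensorPow k (U * V) = tensorPow k U * tensorPow k V := by
  ext α β
  simp only [tensorPow, Matrix.of_apply, Matrix.mul_apply]
  rw [Finset.prod_univ_sum, Fintype.piFinset_univ]
  exact Finset.sum_congr rfl fun γ _ => Finset.prod_mul_distrib

theorem tensorPow_one : tensorPow k (1 : Matrix (Fin d) (Fin d) ℂ) = 1 := by
  ext α β
  simp only [tensorPow, Matrix.of_apply, Matrix.one_apply]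
  by_cases h : α = β
  · simp [h]
  · rw [if_neg h]
    obtain ⟨i, hi⟩ := Function.ne_iff.1 h
    exact Finset.prod_eq_zero (Finset.mem_univ i) (if_neg hi)

theorem unitaryChannel_mul (U V : SU d) :
    unitaryChannel k (U * V) = unitaryChannel k U ∘ₗ unitaryChannel k V := by
  ext1 X
  simp only [unitaryChannel, LinearMap.coe_mk, AddHom.coe_mk, LinearMap.comp_apply,
    Submonoid.coe_mul, star_mul, tensorPow_mul, Matrix.mul_assoc]

theorem unitaryChannel_one : unitaryChannel k (1 : SU d) = LinearMap.id := by
  ext1 X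
  simp [unitaryChannel, tensorPow_one]

/-- The matrices of the unitary channels, as a representation. -/
noncomputable def channelRep (d k : ℕ) : SU d →*
    Matrix ((Fin k → Fin d) × (Fin k → Fin d)) ((Fin k → Fin d) × (Fin k → Fin d)) ℂ where
  toFun U := superMatrix (unitaryChannel k U)
  map_one' := by
    rw [unitaryChannel_one]
    exact LinearMap.toMatrix_id _
  map_mul' U V := by rw [unitaryChannel_mul, superMatrix_comp]

theorem channelRep_apply (U : SU d) : channelRep d k U = superMatrix (unitaryChannel k U) := rfl

theorem unitaryChannel_single (U : SU d) (α β γ δ : Fin k → Fin d) :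
    unitaryChannel k U (Matrix.single β γ 1) α δ =
      tensorPow k (U : Matrix (Fin d) (Fin d) ℂ) α β *
        tensorPow k (star (U : Matrix (Fin d) (Fin d) ℂ)) γ δ := by
  simp [unitaryChannel, Matrix.mul_assoc, Matrix.mul_apply, Matrix.single_apply, ite_and]

theorem star_tensorPow (U : Matrix (Fin d) (Fin d) ℂ) (α β : Fin k → Fin d) :
    star (tensorPow k U α β) = tensorPow k (star U) β α := by
  simp [tensorPow, Matrix.star_apply]

/-- The entry at `(α, δ), (β, γ)` is a product of an entry of `U^{⊗ k}` and one of `U^{† ⊗ k}`;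
conjugate transposition exchanges the roles of `U` and `U† = U⁻¹`. -/
theorem star_channelRep (U : SU d) : star (channelRep d k U) = channelRep d k U⁻¹ := by
  ext ⟨α, δ⟩ ⟨β, γ⟩
  rw [Matrix.star_apply, channelRep_apply, channelRep_apply, superMatrix_apply, superMatrix_apply,
    unitaryChannel_single, unitaryChannel_single, star_mul, star_tensorPow, star_tensorPow,
    SU.coe_inv, mul_comm]

theorem channelRep_mul_star (U : SU d) : channelRep d k U * star (channelRep d k U) = 1 := by
  rw [star_channelRep, ← map_mul, mul_inv_cancel, map_one]

theorem continuous_channelRep : Continuous (channelRep d k) := by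
  refine continuous_matrix ?_
  rintro ⟨α, δ⟩ ⟨β, γ⟩
  simp only [channelRep_apply, superMatrix_apply]
  exact continuous_unitaryChannel_apply d k _ α δ

/-! ### The Haar average -/

instance SU.instIsHaarMeasure (d : ℕ) : (SU.haar d).IsHaarMeasure :=
  inferInstanceAs (Measure.haarMeasure _).IsHaarMeasure

/-- Unimodularity: a right translate of the Haar measure is again a Haar probability measure, hence
equal to it. -/
instance SU.instIsMulRightInvariant (d : ℕ) : (SU.haar d).IsMulRightInvariant where
  map_mul_right_eq_self g := by
    have : IsProbabilityMeasure (Measure.map (· * g) (SU.haar d)) :=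
      Measure.isProbabilityMeasure_map (measurable_mul_const g).aemeasurable
    exact Measure.isHaarMeasure_eq_of_isProbabilityMeasure _ _

theorem superMatrix_haarChannel (i j : (Fin k → Fin d) × (Fin k → Fin d)) :
    superMatrix (haarChannel d k) i j = ∫ U, channelRep d k U i j ∂(SU.haar d) := by
  obtain ⟨α, δ⟩ := i
  obtain ⟨β, γ⟩ := j
  simp only [superMatrix_apply, channelRep_apply]
  rfl

theorem integrable_channelRep (i j : (Fin k → Fin d) × (Fin k → Fin d)) :
    Integrable (fun U => channelRep d k U i j) (SU.haar d) := by
  obtain ⟨α, δ⟩ := i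
  obtain ⟨β, γ⟩ := j
  simp only [channelRep_apply, superMatrix_apply]
  exact integrable_unitaryChannel_apply d k _ α δ

theorem mul_superMatrix_haarChannel
    (X : Matrix ((Fin k → Fin d) × (Fin k → Fin d)) ((Fin k → Fin d) × (Fin k → Fin d)) ℂ)
    (i j : (Fin k → Fin d) × (Fin k → Fin d)) :
    (X * superMatrix (haarChannel d k)) i j =
      ∫ U, (X * channelRep d k U) i j ∂(SU.haar d) := by
  simp only [Matrix.mul_apply, superMatrix_haarChannel]
  rw [integral_finsetSum _ fun l _ => (integrable_channelRep l j).const_mul _]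
  exact Finset.sum_congr rfl fun l _ => (integral_const_mul _ _).symm

theorem superMatrix_haarChannel_mul
    (X : Matrix ((Fin k → Fin d) × (Fin k → Fin d)) ((Fin k → Fin d) × (Fin k → Fin d)) ℂ)
    (i j : (Fin k → Fin d) × (Fin k → Fin d)) :
    (superMatrix (haarChannel d k) * X) i j =
      ∫ U, (channelRep d k U * X) i j ∂(SU.haar d) := by
  simp only [Matrix.mul_apply, superMatrix_haarChannel]
  rw [integral_finsetSum _ fun l _ => (integrable_channelRep i l).mul_const _]
  exact Finset.sum_congr rfl fun l _ => (integral_mul_const _ _).symm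

theorem mul_superMatrix_haarChannel_of_invariant
    (X : Matrix ((Fin k → Fin d) × (Fin k → Fin d)) ((Fin k → Fin d) × (Fin k → Fin d)) ℂ)
    (hX : ∀ g, X * channelRep d k g = X) : X * superMatrix (haarChannel d k) = X := by
  ext i j
  simp [mul_superMatrix_haarChannel, hX]

/-- Left invariance of the measure. This is what makes `P` annihilate the deviations. -/
theorem channelRep_mul_superMatrix_haarChannel (g : SU d) :
    channelRep d k g * superMatrix (haarChannel d k) = superMatrix (haarChannel d k) := by
  ext i j
  rw [mul_superMatrix_haarChannel, superMatrix_haarChannel]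
  simp only [← map_mul]
  exact integral_mul_left_eq_self (fun U => channelRep d k U i j) g

/-- Right invariance of the measure. It lets the deviations obey the same recursion as the time
averages, with no leftover Haar term. -/
theorem superMatrix_haarChannel_mul_channelRep (g : SU d) :
    superMatrix (haarChannel d k) * channelRep d k g = superMatrix (haarChannel d k) := by
  ext i j
  rw [superMatrix_haarChannel_mul, superMatrix_haarChannel]
  simp only [← map_mul]
  exact integral_mul_right_eq_self (fun U => channelRep d k U i j) g

end Superoperators

/-! ### The Thue–Morse recursion -/

section Recursion

variable {d k : ℕ}

/-- The position `2 ^ n + j` falls in the second, negated half of `word (n + 1)`. -/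
theorem letter_two_pow_add (n j : ℕ) (h : j < 2 ^ n) : letter (2 ^ n + j) = !letter j := by
  have h2 : 2 ^ n + j < 2 ^ (n + 1) := by
    rw [pow_succ]
    omega
  have hlen : j < (word n).length := by rwa [length_word]
  rw [← word_getD (n + 1) _ h2, ← word_getD n j h, word,
    List.getD_append_right _ _ _ _ (by rw [length_word]; omega), length_word,
    Nat.add_sub_cancel_left]
  simp [List.getD_eq_getElem?_getD, List.getElem?_map, List.getElem?_eq_getElem hlen]

/-- After time `2 ^ n` the drive runs with the letters exchanged. The endpoint `j = 2 ^ n` is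
allowed since `U(t)` only uses letters of index below `t`; it yields `A_{n+1} = B_n A_n`. -/
theorem evolution_two_pow_add (A B : SU d) (n j : ℕ) (h : j ≤ 2 ^ n) :
    evolution A B (2 ^ n + j) = evolution B A j * evolution A B (2 ^ n) := by
  induction j with
  | zero => simp [evolution]
  | succ j ih =>
    rw [← Nat.add_assoc, evolution, evolution, ih (by omega), letter_two_pow_add n j (by omega),
      mul_assoc]
    cases letter j <;> simp

theorem unitaryB_eq_unitaryA (A B : SU d) (n : ℕ) : unitaryB A B n = unitaryA B A n := rfl

theorem unitaryA_zero (A B : SU d) : unitaryA A B 0 = A := by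
  simp [unitaryA, evolution, letter, word]

theorem unitaryA_succ (A B : SU d) (n : ℕ) :
    unitaryA A B (n + 1) = unitaryB A B n * unitaryA A B n := by
  rw [unitaryA, pow_succ, mul_two, evolution_two_pow_add A B n _ le_rfl]
  rfl

theorem unitaryB_succ (A B : SU d) (n : ℕ) :
    unitaryB A B (n + 1) = unitaryA A B n * unitaryB A B n :=
  unitaryA_succ B A n

theorem timeAverage_two_pow_succ (A B : SU d) (n : ℕ) :
    timeAverage k A B (2 ^ (n + 1)) = (2⁻¹ : ℂ) •
      (timeAverage k A B (2 ^ n) + timeAverage k B A (2 ^ n) ∘ₗ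
        unitaryChannel k (unitaryA A B n)) := by
  have h : ∑ t ∈ Finset.range (2 ^ n), unitaryChannel k (evolution A B (2 ^ n + t)) =
      (∑ t ∈ Finset.range (2 ^ n), unitaryChannel k (evolution B A t)) ∘ₗ
        unitaryChannel k (unitaryA A B n) := by
    ext1 X
    simp only [LinearMap.comp_apply, LinearMap.sum_apply]
    refine Finset.sum_congr rfl fun t ht => ?_
    rw [evolution_two_pow_add A B n t (Finset.mem_range.1 ht).le, unitaryChannel_mul]
    rfl
  simp only [timeAverage]
  rw [LinearMap.smul_comp, ← smul_add, ← h, smul_smul, pow_succ, mul_two,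
    Finset.sum_range_add, ← two_mul]
  push_cast
  rw [mul_inv]

/-- The matrix of the deviation of a time average from the Haar average. -/
noncomputable def deviation (k : ℕ) (A B : SU d) (n : ℕ) :
    Matrix ((Fin k → Fin d) × (Fin k → Fin d)) ((Fin k → Fin d) × (Fin k → Fin d)) ℂ :=
  superMatrix (timeAverage k A B (2 ^ n) - haarChannel d k)

theorem monotone_eq (A B : SU d) (n : ℕ) :
    monotone k A B n = frobSq (deviation k A B n) + frobSq (deviation k B A n) := by
  rw [monotone, hsNorm_sq, hsNorm_sq]
  rfl

theorem deviation_succ (A B : SU d) (n : ℕ) :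
    deviation k A B (n + 1) =
      avgStep (channelRep d k) (unitaryA A B n) (deviation k A B n) (deviation k B A n) := by
  simp only [deviation, avgStep, timeAverage_two_pow_succ, superMatrix_sub, superMatrix_smul,
    superMatrix_add, superMatrix_comp, ← channelRep_apply, Matrix.sub_mul,
    superMatrix_haarChannel_mul_channelRep]
  module

/-- Every term of the time average, multiplied by `P`, becomes `P`, and `P` is idempotent. The
deviations thus have no component on the invariants, where no contraction is possible. -/
theorem deviation_mul_haarChannel (A B : SU d) (n : ℕ) :
    deviation k A B n * superMatrix (haarChannel d k) = 0 := by
  have h0 : superMatrix (haarChannel d k) * superMatrix (haarChannel d k) =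
      superMatrix (haarChannel d k) :=
    mul_superMatrix_haarChannel_of_invariant _ superMatrix_haarChannel_mul_channelRep
  have h1 : ∀ s : Finset ℕ, superMatrix (∑ t ∈ s, unitaryChannel k (evolution A B t)) =
      ∑ t ∈ s, channelRep d k (evolution A B t) := fun s => map_sum (LinearMap.toMatrix _ _) _ _
  rw [deviation, superMatrix_sub, timeAverage, superMatrix_smul, h1, Matrix.sub_mul, h0,
    Matrix.smul_mul, Finset.sum_mul]
  simp only [channelRep_mul_superMatrix_haarChannel]
  rw [Finset.sum_const, Finset.card_range, ← Nat.cast_smul_eq_nsmul ℂ, smul_smul,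
    inv_mul_cancel₀ (by simp), one_smul, sub_self]

theorem monotone_succ (A B : SU d) (n : ℕ) :
    monotone k A B (n + 1) =
      frobSq (avgStep (channelRep d k) (unitaryA A B n) (deviation k A B n) (deviation k B A n)) +
      frobSq (avgStep (channelRep d k) (unitaryB A B n) (deviation k B A n)
        (deviation k A B n)) := by
  rw [monotone_eq, deviation_succ, deviation_succ]
  rfl

theorem monotone_succ_le (A B : SU d) (n : ℕ) : monotone k A B (n + 1) ≤ monotone k A B n := by
  rw [monotone_succ, monotone_eq]
  exact frobSq_avgStep_add_le channelRep_mul_star _ _ _ _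

theorem monotone_add_two (A B : SU d) (n : ℕ) :
    monotone k A B (n + 2) = energyTwo (channelRep d k) (unitaryA A B n) (unitaryB A B n)
      (deviation k A B n) (deviation k B A n) := by
  rw [monotone_succ, unitaryA_succ, unitaryB_succ, deviation_succ, deviation_succ]
  rfl

theorem deviation_eq_iff (A B A' B' : SU d) (n : ℕ) (g : SU d) :
    deviation k A B n = deviation k A' B' n * channelRep d k g ↔
      timeAverage k A B (2 ^ n) = timeAverage k A' B' (2 ^ n) ∘ₗ unitaryChannel k g := by
  rw [deviation, deviation, superMatrix_sub, superMatrix_sub, Matrix.sub_mul,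
    superMatrix_haarChannel_mul_channelRep, sub_left_inj, channelRep_apply, ← superMatrix_comp,
    superMatrix_injective.eq_iff]

theorem timeAverage_succ_of_eq (A B : SU d) (n : ℕ)
    (h : timeAverage k A B (2 ^ n) =
      timeAverage k B A (2 ^ n) ∘ₗ unitaryChannel k (unitaryA A B n)) :
    timeAverage k A B (2 ^ (n + 1)) = timeAverage k A B (2 ^ n) := by
  rw [timeAverage_two_pow_succ, ← h, ← two_smul ℂ (timeAverage k A B (2 ^ n)), smul_smul]
  norm_num

theorem monotone_succ_eq_iff (A B : SU d) (n : ℕ) :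
    monotone k A B (n + 1) = monotone k A B n ↔
      (timeAverage k A B (2 ^ (n + 1)) = timeAverage k A B (2 ^ n) ∧
        timeAverage k A B (2 ^ n) =
          timeAverageBar k A B (2 ^ n) ∘ₗ unitaryChannel k (unitaryA A B n)) ∧
      (timeAverageBar k A B (2 ^ (n + 1)) = timeAverageBar k A B (2 ^ n) ∧
        timeAverageBar k A B (2 ^ n) =
          timeAverage k A B (2 ^ n) ∘ₗ unitaryChannel k (unitaryB A B n)) := by
  rw [monotone_succ, monotone_eq, frobSq_avgStep_add_eq_iff channelRep_mul_star,
    deviation_eq_iff, deviation_eq_iff]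
  constructor
  · rintro ⟨h1, h2⟩
    exact ⟨⟨timeAverage_succ_of_eq A B n h1, h1⟩, timeAverage_succ_of_eq B A n h2, h2⟩
  · rintro ⟨⟨-, h1⟩, -, h2⟩
    exact ⟨h1, h2⟩

/-- Uniform contraction near a compact set of generating pairs. -/
theorem exists_monotone_add_three_le (k : ℕ) {K : Set (SU d × SU d)} (hK : IsCompact K)
    (hgen : ∀ p ∈ K, Generates p.1 p.2) :
    ∃ Ω : Set (SU d × SU d), IsOpen Ω ∧ K ⊆ Ω ∧ ∃ δ : ℝ, 0 < δ ∧
      ∀ (A B : SU d) (n : ℕ), (unitaryA A B n, unitaryB A B n) ∈ Ω →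
        monotone k A B (n + 3) ≤ (1 - δ) * monotone k A B n := by
  obtain ⟨Ω, hΩ, hKΩ, δ, hδ, h⟩ := exists_energyTwo_le channelRep_mul_star continuous_channelRep
    (superMatrix (haarChannel d k)) mul_superMatrix_haarChannel_of_invariant hK hgen
  -- Two steps already contract; the third only uses monotonicity.
  refine ⟨Ω, hΩ, hKΩ, δ, hδ, fun A B n hn => (monotone_succ_le A B (n + 2)).trans ?_⟩
  rw [monotone_add_two, monotone_eq]
  exact h _ _ _ _ hn (deviation_mul_haarChannel A B n) (deviation_mul_haarChannel B A n)

end Recursion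

/-! ### Entries of matrices in `SU(2)` -/

section Entries

/-- Both are the inverse of `U`, as `det U = 1`. Consequently an element of `SU(2)` is determined by
its first column. -/
theorem SU2.star_eq_adjugate (U : SU 2) :
    star (U : Matrix (Fin 2) (Fin 2) ℂ) = Matrix.adjugate (U : Matrix (Fin 2) (Fin 2) ℂ) := by
  have h := Matrix.mem_specialUnitaryGroup_iff.1 U.2
  have h1 := (Matrix.mem_unitaryGroup_iff).1 h.1
  have h2 := Matrix.adjugate_mul (U : Matrix (Fin 2) (Fin 2) ℂ)
  rw [h.2, one_smul] at h2
  calc star (U : Matrix (Fin 2) (Fin 2) ℂ)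
      = (Matrix.adjugate (U : Matrix (Fin 2) (Fin 2) ℂ) * (U : Matrix (Fin 2) (Fin 2) ℂ)) *
          star (U : Matrix (Fin 2) (Fin 2) ℂ) := by
        rw [h2, Matrix.one_mul]
    _ = _ := by rw [Matrix.mul_assoc, h1, Matrix.mul_one]

theorem SU2.apply_one_one (U : SU 2) :
    (U : Matrix (Fin 2) (Fin 2) ℂ) 1 1 = star ((U : Matrix (Fin 2) (Fin 2) ℂ) 0 0) := by
  have := congrFun (congrFun (SU2.star_eq_adjugate U) 0) 0
  simpa [Matrix.adjugate_fin_two, Matrix.star_apply] using this.symm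

theorem SU2.apply_zero_one (U : SU 2) :
    (U : Matrix (Fin 2) (Fin 2) ℂ) 0 1 = -star ((U : Matrix (Fin 2) (Fin 2) ℂ) 1 0) := by
  have := congrFun (congrFun (SU2.star_eq_adjugate U) 0) 1
  simp only [Matrix.adjugate_fin_two, Matrix.star_apply, Matrix.of_apply, Matrix.cons_val',
    Matrix.cons_val_zero, Matrix.cons_val_one] at this
  rw [this, neg_neg]

theorem SU2.normSq_add_normSq (U : SU 2) :
    Complex.normSq ((U : Matrix (Fin 2) (Fin 2) ℂ) 0 0) +
      Complex.normSq ((U : Matrix (Fin 2) (Fin 2) ℂ) 1 0) = 1 := by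
  have h := (Matrix.mem_specialUnitaryGroup_iff.1 U.2).2
  rw [Matrix.det_fin_two, SU2.apply_one_one, SU2.apply_zero_one] at h
  have h2 : ((Complex.normSq ((U : Matrix (Fin 2) (Fin 2) ℂ) 0 0) +
      Complex.normSq ((U : Matrix (Fin 2) (Fin 2) ℂ) 1 0) : ℝ) : ℂ) = 1 := by
    push_cast
    rw [Complex.normSq_eq_conj_mul_self, Complex.normSq_eq_conj_mul_self, ← h]
    simp only [← starRingEnd_apply]
    ring
  exact_mod_cast h2

theorem SU2.mul_zero_zero (U V : SU 2) :
    ((U * V : SU 2) : Matrix (Fin 2) (Fin 2) ℂ) 0 0 =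
      (U : Matrix (Fin 2) (Fin 2) ℂ) 0 0 * (V : Matrix (Fin 2) (Fin 2) ℂ) 0 0 -
      star ((U : Matrix (Fin 2) (Fin 2) ℂ) 1 0) * (V : Matrix (Fin 2) (Fin 2) ℂ) 1 0 := by
  rw [Submonoid.coe_mul, Matrix.mul_apply, Fin.sum_univ_two, SU2.apply_zero_one]
  ring

theorem SU2.mul_one_zero (U V : SU 2) :
    ((U * V : SU 2) : Matrix (Fin 2) (Fin 2) ℂ) 1 0 =
      (U : Matrix (Fin 2) (Fin 2) ℂ) 1 0 * (V : Matrix (Fin 2) (Fin 2) ℂ) 0 0 +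
      star ((U : Matrix (Fin 2) (Fin 2) ℂ) 0 0) * (V : Matrix (Fin 2) (Fin 2) ℂ) 1 0 := by
  rw [Submonoid.coe_mul, Matrix.mul_apply, Fin.sum_univ_two, SU2.apply_one_one]

theorem SU2.ext_col {U V : SU 2}
    (h0 : (U : Matrix (Fin 2) (Fin 2) ℂ) 0 0 = (V : Matrix (Fin 2) (Fin 2) ℂ) 0 0)
    (h1 : (U : Matrix (Fin 2) (Fin 2) ℂ) 1 0 = (V : Matrix (Fin 2) (Fin 2) ℂ) 1 0) : U = V := by
  apply Subtype.ext
  ext i j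
  fin_cases i <;> fin_cases j
  · exact h0
  · change (U : Matrix (Fin 2) (Fin 2) ℂ) 0 1 = (V : Matrix (Fin 2) (Fin 2) ℂ) 0 1
    rw [SU2.apply_zero_one, SU2.apply_zero_one, h1]
  · exact h1
  · change (U : Matrix (Fin 2) (Fin 2) ℂ) 1 1 = (V : Matrix (Fin 2) (Fin 2) ℂ) 1 1
    rw [SU2.apply_one_one, SU2.apply_one_one, h0]

/-- The element of `SU(2)` with a given first column. -/
noncomputable def SU2.mk (p q : ℂ) (h : Complex.normSq p + Complex.normSq q = 1) : SU 2 :=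
  ⟨!![p, -star q; q, star p], by
    have h' : p * star p + q * star q = 1 := by
      simp only [← starRingEnd_apply, Complex.mul_conj]
      exact_mod_cast h
    rw [Matrix.mem_specialUnitaryGroup_iff, Matrix.mem_unitaryGroup_iff]
    constructor
    · ext i j
      fin_cases i <;> fin_cases j <;>
        simp [Matrix.mul_apply, Fin.sum_univ_two, Matrix.star_apply] <;>
        simp only [Complex.star_def] at h' <;> first | linear_combination h' | ring
    · rw [Matrix.det_fin_two_of]
      linear_combination h'⟩

theorem SU2.mk_zero_zero (p q : ℂ) (h : Complex.normSq p + Complex.normSq q = 1) :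
    (SU2.mk p q h : Matrix (Fin 2) (Fin 2) ℂ) 0 0 = p := rfl

theorem SU2.mk_one_zero (p q : ℂ) (h : Complex.normSq p + Complex.normSq q = 1) :
    (SU2.mk p q h : Matrix (Fin 2) (Fin 2) ℂ) 1 0 = q := rfl

/-- The diagonal matrix with entries `z` and `z⁻¹`. -/
noncomputable def SU2.diag (z : Circle) : SU 2 := SU2.mk z 0 (by simp)

theorem SU2.diag_zero_zero (z : Circle) :
    (SU2.diag z : Matrix (Fin 2) (Fin 2) ℂ) 0 0 = z := rfl

theorem SU2.diag_one_zero (z : Circle) :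
    (SU2.diag z : Matrix (Fin 2) (Fin 2) ℂ) 1 0 = 0 := rfl

theorem SU2.diag_mul (z w : Circle) : SU2.diag (z * w) = SU2.diag z * SU2.diag w := by
  apply SU2.ext_col
  · simp [SU2.mul_zero_zero, SU2.diag_zero_zero, SU2.diag_one_zero]
  · simp [SU2.mul_one_zero, SU2.diag_zero_zero, SU2.diag_one_zero]

theorem SU2.diag_one : SU2.diag 1 = 1 := by
  apply SU2.ext_col <;> simp [SU2.diag_zero_zero, SU2.diag_one_zero]

theorem SU2.continuous_diag : Continuous SU2.diag := by
  refine Continuous.subtype_mk (continuous_matrix fun i j => ?_) _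
  fin_cases i <;> fin_cases j <;> simp <;> fun_prop

theorem continuous_entry (i j : Fin 2) :
    Continuous fun U : SU 2 => (U : Matrix (Fin 2) (Fin 2) ℂ) i j :=
  continuous_subtype_val.matrix_elem i j

end Entries

/-! ### Dense subgroups of `SU(2)` -/

section Dense

/-- Kronecker: `θ / 2π` is irrational, so `ℤθ + 2πℤ` is dense in `ℝ`, and the closed preimage of `H`
under the exponential contains it. -/
theorem Circle.exp_mem_of_isClosed {H : Set Circle} {θ : ℝ} (hθ : ∀ m : ℕ, 0 < m →
    Circle.exp θ ^ m ≠ 1) (hH : IsClosed H) (hz : ∀ m : ℤ, Circle.exp θ ^ m ∈ H) (z : Circle) :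
    z ∈ H := by
  have hirr : Irrational (θ / (2 * Real.pi)) := by
    rintro ⟨q, hq⟩
    refine hθ q.den q.pos ?_
    have hden : (q.den : ℝ) ≠ 0 := by exact_mod_cast q.den_nz
    have hpi : (2 * Real.pi) ≠ 0 := by positivity
    have h1 : (q.den : ℝ) * θ = q.num * (2 * Real.pi) := by
      rw [Rat.cast_def, div_eq_div_iff hden hpi] at hq
      linarith
    have h2 : Circle.exp ((q.den : ℝ) * θ) = Circle.exp θ ^ q.den := by
      rw [← nsmul_eq_mul, Circle.exp_nsmul]
    rw [← h2, h1]
    exact Circle.exp_int_mul_two_pi _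
  have hdense := dense_addSubgroupClosure_pair_iff.2 hirr
  have hpre : IsClosed (Circle.exp ⁻¹' H) := hH.preimage Circle.exp.continuous
  have hsub : (AddSubgroup.closure {θ, 2 * Real.pi} : Set ℝ) ⊆ Circle.exp ⁻¹' H := by
    intro x hx
    obtain ⟨m, n, rfl⟩ := AddSubgroup.mem_closure_pair.1 hx
    have : Circle.exp (m • θ + n • (2 * Real.pi)) = Circle.exp θ ^ m := by
      rw [Circle.exp_add, zsmul_eq_mul, zsmul_eq_mul, Circle.exp_int_mul_two_pi, mul_one,
        ← zsmul_eq_mul, Circle.exp_zsmul]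
    rw [Set.mem_preimage, this]
    exact hz m
  obtain ⟨x, rfl⟩ : ∃ x, Circle.exp x = z := ⟨_, Circle.exp_arg z⟩
  exact hpre.closure_subset_iff.2 hsub (hdense x)

theorem exists_exp_mul_eq {a b : ℂ} (h : ‖a‖ = ‖b‖) : ∃ x : ℝ, b = Circle.exp x * a := by
  rcases eq_or_ne a 0 with rfl | ha
  · exact ⟨0, by rw [norm_zero, eq_comm, norm_eq_zero] at h; simp [h]⟩
  · refine ⟨Complex.arg (b / a), ?_⟩
    have h1 : ‖b / a‖ = 1 := by rw [norm_div, h, div_self]; rwa [← h, norm_ne_zero_iff]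
    have h2 := Complex.norm_mul_exp_arg_mul_I (b / a)
    rw [h1, Complex.ofReal_one, one_mul] at h2
    rw [Circle.coe_exp, h2, div_mul_cancel₀ _ ha]

variable {G : Subgroup (SU 2)}

/-- The double cosets of the diagonal torus are determined by the modulus of the first entry. -/
theorem mem_of_norm_eq (hT : ∀ z, SU2.diag z ∈ G) {U W : SU 2} (hU : U ∈ G)
    (h : ‖(U : Matrix (Fin 2) (Fin 2) ℂ) 0 0‖ = ‖(W : Matrix (Fin 2) (Fin 2) ℂ) 0 0‖) :
    W ∈ G := by
  have h' : ‖(U : Matrix (Fin 2) (Fin 2) ℂ) 1 0‖ = ‖(W : Matrix (Fin 2) (Fin 2) ℂ) 1 0‖ := by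
    have hU2 := SU2.normSq_add_normSq U
    have hW2 := SU2.normSq_add_normSq W
    simp only [Complex.normSq_eq_norm_sq] at hU2 hW2
    rw [h] at hU2
    exact (sq_eq_sq₀ (norm_nonneg _) (norm_nonneg _)).1 (by linarith)
  obtain ⟨x, hx⟩ := exists_exp_mul_eq h
  obtain ⟨y, hy⟩ := exists_exp_mul_eq h'
  -- The upper entry acquires the sum of the two phases, namely `x`, the lower one their difference,
  -- namely `y`.
  have hW : W = SU2.diag (Circle.exp ((x - y) / 2)) * U * SU2.diag (Circle.exp ((x + y) / 2)) := by
    apply SU2.ext_col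
    · rw [hx, SU2.mul_zero_zero, SU2.mul_zero_zero, SU2.diag_zero_zero, SU2.diag_zero_zero,
        SU2.diag_one_zero, SU2.diag_one_zero, star_zero, zero_mul, sub_zero, mul_zero, sub_zero,
        mul_right_comm, ← Circle.coe_mul, ← Circle.exp_add]
      congr 3
      ring
    · have hs : star ((Circle.exp ((x - y) / 2) : Circle) : ℂ) =
          (Circle.exp (-((x - y) / 2)) : Circle) := by
        rw [Circle.exp_neg, Circle.coe_inv_eq_conj]
        rfl
      rw [hy, SU2.mul_one_zero, SU2.mul_one_zero, SU2.diag_zero_zero, SU2.diag_zero_zero,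
        SU2.diag_one_zero, SU2.diag_one_zero, zero_mul, zero_add, mul_zero, add_zero, hs,
        mul_right_comm, ← Circle.coe_mul, ← Circle.exp_add]
      congr 3
      ring
  rw [hW]
  exact G.mul_mem (G.mul_mem (hT _) hU) (hT _)

/-- The squared moduli of the first entries of the elements of `G`. -/
def firstEntries (G : Subgroup (SU 2)) : Set ℝ :=
  (fun U : SU 2 => ‖(U : Matrix (Fin 2) (Fin 2) ℂ) 0 0‖ ^ 2) '' (G : Set (SU 2))

/-- `G` contains the real rotation `R` with squared first entry `p`, and the first entry of `R
diag(e^{iθ}) R` has squared modulus `(2p - 1)² cos² θ + sin² θ`, which sweeps the interval. -/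
theorem Icc_subset_firstEntries (hT : ∀ z, SU2.diag z ∈ G) {p : ℝ} (hp : p ∈ firstEntries G) :
    Set.Icc ((2 * p - 1) ^ 2) 1 ⊆ firstEntries G := by
  obtain ⟨U, hU, hUp⟩ := hp
  simp only at hUp
  have hp0 : 0 ≤ p := by rw [← hUp]; positivity
  have hp1 : p ≤ 1 := by
    have := SU2.normSq_add_normSq U
    rw [Complex.normSq_eq_norm_sq, hUp] at this
    linarith [Complex.normSq_nonneg ((U : Matrix (Fin 2) (Fin 2) ℂ) 1 0)]
  have hx := Real.sq_sqrt hp0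
  have hy := Real.sq_sqrt (sub_nonneg.2 hp1)
  set x := Real.sqrt p
  set y := Real.sqrt (1 - p)
  let R : SU 2 := SU2.mk x y (by
    rw [Complex.normSq_ofReal, Complex.normSq_ofReal]
    linarith)
  have hR : R ∈ G := by
    refine mem_of_norm_eq hT hU ((sq_eq_sq₀ (norm_nonneg _) (norm_nonneg _)).1 ?_)
    rw [hUp, SU2.mk_zero_zero, Complex.norm_real, Real.norm_eq_abs, sq_abs, hx]
  let f : ℝ → ℝ := fun θ =>
    ‖((R * SU2.diag (Circle.exp θ) * R : SU 2) : Matrix (Fin 2) (Fin 2) ℂ) 0 0‖ ^ 2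
  have hf : ∀ θ, f θ = (2 * p - 1) ^ 2 * Real.cos θ ^ 2 + Real.sin θ ^ 2 := by
    intro θ
    simp only [f]
    rw [← Complex.normSq_eq_norm_sq, SU2.mul_zero_zero, SU2.mul_zero_zero, SU2.mul_one_zero,
      SU2.diag_zero_zero, SU2.diag_one_zero, SU2.mk_zero_zero, SU2.mk_one_zero, Circle.coe_exp,
      Complex.normSq_apply]
    simp [Complex.exp_re, Complex.exp_im]
    have h1 : x * Real.cos θ * x - y * Real.cos θ * y = (2 * p - 1) * Real.cos θ := by
      linear_combination Real.cos θ * hx - Real.cos θ * hy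
    have h2 : x * Real.sin θ * x + y * Real.sin θ * y = Real.sin θ := by
      linear_combination Real.sin θ * hx + Real.sin θ * hy
    rw [h1, h2]
    ring
  have hc : Continuous f := by
    rw [show f = _ from funext hf]
    fun_prop
  intro r hr
  have h0 : f 0 = (2 * p - 1) ^ 2 := by simp [hf]
  have h1 : f (Real.pi / 2) = 1 := by simp [hf]
  obtain ⟨θ, -, hθ⟩ := intermediate_value_Icc (by positivity : (0 : ℝ) ≤ Real.pi / 2)
    hc.continuousOn (by rwa [h0, h1] : r ∈ Set.Icc (f 0) (f (Real.pi / 2)))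
  exact ⟨_, G.mul_mem (G.mul_mem hR (hT _)) hR, hθ⟩

/-- A closed subgroup of `SU(2)` containing the diagonal torus, but not contained in its
normaliser, is everything. -/
theorem eq_top_of_torus_le (hG : IsClosed (G : Set (SU 2))) (hT : ∀ z, SU2.diag z ∈ G)
    {V : SU 2} (hV : V ∈ G) (h0 : (V : Matrix (Fin 2) (Fin 2) ℂ) 0 0 ≠ 0)
    (h1 : (V : Matrix (Fin 2) (Fin 2) ℂ) 1 0 ≠ 0) : G = ⊤ := by
  have hcomp : IsCompact (firstEntries G) :=
    hG.isCompact.image ((continuous_entry 0 0).norm.pow 2)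
  have hle : ∀ W : SU 2, ‖(W : Matrix (Fin 2) (Fin 2) ℂ) 0 0‖ ^ 2 ≤ 1 := fun W => by
    have := SU2.normSq_add_normSq W
    rw [Complex.normSq_eq_norm_sq] at this
    linarith [Complex.normSq_nonneg ((W : Matrix (Fin 2) (Fin 2) ℂ) 1 0)]
  -- The value `1/2` suffices, since there `(2p - 1)² = 0` and the interval is all of `[0, 1]`.
  have hhalf : (1 / 2 : ℝ) ∈ firstEntries G := by
    set p := ‖(V : Matrix (Fin 2) (Fin 2) ℂ) 0 0‖ ^ 2 with hp
    have hpS : p ∈ firstEntries G := ⟨V, hV, rfl⟩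
    have hp0 : 0 < p := by positivity
    have hp1 : p < 1 := by
      have := SU2.normSq_add_normSq V
      rw [Complex.normSq_eq_norm_sq, ← hp] at this
      linarith [Complex.normSq_pos.2 h1]
    have hq1 : max ((2 * p - 1) ^ 2) (1 / 2) < 1 := by
      refine max_lt ?_ (by norm_num)
      nlinarith
    have hqS : max ((2 * p - 1) ^ 2) (1 / 2) ∈ firstEntries G :=
      Icc_subset_firstEntries hT hpS ⟨le_max_left _ _, hq1.le⟩
    -- For the least attained `q ≥ 1/2` one has `(2q - 1)² < q`, because `(4q - 1)(q - 1) < 0`.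
    -- Minimality then pushes `(2q - 1)²` below `1/2`, so the interval reaches `1/2`.
    obtain ⟨q, ⟨hqG, hqhalf⟩, hqmin⟩ := (hcomp.inter_right (isClosed_Ici (a := (1 / 2 : ℝ)))
      ).exists_isLeast ⟨_, hqS, Set.mem_Ici.2 (le_max_right _ _)⟩
    have hqhalf : 1 / 2 ≤ q := hqhalf
    have hq2 : q < 1 := (hqmin ⟨hqS, Set.mem_Ici.2 (le_max_right _ _)⟩).trans_lt hq1
    have hlt : (2 * q - 1) ^ 2 < q := by nlinarith
    rcases le_total ((2 * q - 1) ^ 2) (1 / 2) with h | h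
    · exact Icc_subset_firstEntries hT hqG ⟨h, by norm_num⟩
    · have := hqmin ⟨Icc_subset_firstEntries hT hqG ⟨le_rfl, by linarith⟩, h⟩
      linarith
  rw [eq_top_iff]
  intro W _
  obtain ⟨U, hU, hUW⟩ := Icc_subset_firstEntries hT hhalf
    (Set.mem_Icc.2 ⟨by norm_num, hle W⟩)
  exact mem_of_norm_eq hT hU ((sq_eq_sq₀ (norm_nonneg _) (norm_nonneg _)).1 hUW)

theorem cosAngle_eq (U : SU 2) :
    cosAngle (U : Matrix (Fin 2) (Fin 2) ℂ) = ((U : Matrix (Fin 2) (Fin 2) ℂ) 0 0).re := by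
  simp [cosAngle, Matrix.trace_fin_two, SU2.apply_one_one]

theorem cosAngle_conj (P U : SU 2) :
    cosAngle ((P⁻¹ * U * P : SU 2) : Matrix (Fin 2) (Fin 2) ℂ) =
      cosAngle (U : Matrix (Fin 2) (Fin 2) ℂ) := by
  have h : (P : Matrix (Fin 2) (Fin 2) ℂ) * ((P⁻¹ : SU 2) : Matrix (Fin 2) (Fin 2) ℂ) = 1 := by
    rw [← Submonoid.coe_mul, mul_inv_cancel, Submonoid.coe_one]
  rw [cosAngle, cosAngle, Submonoid.coe_mul, Matrix.trace_mul_comm, Submonoid.coe_mul,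
    ← Matrix.mul_assoc, h, Matrix.one_mul]

/-- `z` is a root of the characteristic polynomial `z² - 2 cos α z + 1`; a unit eigenvector is the
first column of `P`. -/
theorem exists_diagonalization (U : SU 2) (z : Circle)
    (hz : (z : ℂ).re = cosAngle (U : Matrix (Fin 2) (Fin 2) ℂ)) :
    ∃ P : SU 2, P⁻¹ * U * P = SU2.diag z := by
  set M : Matrix (Fin 2) (Fin 2) ℂ := (U : Matrix (Fin 2) (Fin 2) ℂ) with hM
  have hdet : (M - (z : ℂ) • (1 : Matrix (Fin 2) (Fin 2) ℂ)).det = 0 := by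
    have hn : M 0 0 * star (M 0 0) + star (M 1 0) * M 1 0 = 1 := by
      have := SU2.normSq_add_normSq U
      have h2 : ((Complex.normSq (M 0 0) + Complex.normSq (M 1 0) : ℝ) : ℂ) = 1 := by
        rw [this, Complex.ofReal_one]
      rw [Complex.ofReal_add, ← Complex.mul_conj, Complex.normSq_eq_conj_mul_self] at h2
      exact h2
    have htr : M 0 0 + star (M 0 0) = z + star (z : ℂ) := by
      rw [cosAngle_eq] at hz
      rw [← starRingEnd_apply, ← starRingEnd_apply, Complex.add_conj, Complex.add_conj, ← hz]
    have hzz : (z : ℂ) * star (z : ℂ) = 1 := by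
      rw [← starRingEnd_apply, Complex.mul_conj, Circle.normSq_coe, Complex.ofReal_one]
    have e11 : M 1 1 = star (M 0 0) := SU2.apply_one_one U
    have e01 : M 0 1 = -star (M 1 0) := SU2.apply_zero_one U
    rw [Matrix.det_fin_two]
    simp only [Matrix.sub_apply, Matrix.smul_apply, Matrix.one_apply_eq, smul_eq_mul, mul_one, e11,
      e01, Matrix.one_apply_ne (zero_ne_one' (Fin 2)), Matrix.one_apply_ne (one_ne_zero' (Fin 2)),
      mul_zero, sub_zero]
    linear_combination hn - (z : ℂ) * htr - hzz
  obtain ⟨v, hv, hMv⟩ := Matrix.exists_mulVec_eq_zero_iff.2 hdet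
  have hn : 0 < Complex.normSq (v 0) + Complex.normSq (v 1) := by
    by_contra hcon
    have h0 := Complex.normSq_nonneg (v 0)
    have h1 := Complex.normSq_nonneg (v 1)
    apply hv
    have h2 : v 0 = 0 := Complex.normSq_eq_zero.1 (by linarith)
    have h3 : v 1 = 0 := Complex.normSq_eq_zero.1 (by linarith)
    ext i
    fin_cases i
    exacts [h2, h3]
  set s := Real.sqrt (Complex.normSq (v 0) + Complex.normSq (v 1)) with hs
  have hs2 : s * s = Complex.normSq (v 0) + Complex.normSq (v 1) := Real.mul_self_sqrt hn.le
  let P : SU 2 := SU2.mk (v 0 / s) (v 1 / s) (by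
    rw [Complex.normSq_div, Complex.normSq_div, Complex.normSq_ofReal, hs2, ← add_div,
      div_self hn.ne'])
  refine ⟨P, ?_⟩
  rw [mul_assoc, inv_mul_eq_iff_eq_mul]
  have hrow : ∀ i, M i 0 * v 0 + M i 1 * v 1 = z * v i := by
    intro i
    have := congrFun hMv i
    rw [Matrix.sub_mulVec, Matrix.smul_mulVec, Matrix.one_mulVec] at this
    simp only [Pi.sub_apply, Matrix.mulVec, dotProduct, Fin.sum_univ_two, Pi.smul_apply,
      smul_eq_mul, Pi.zero_apply] at this
    linear_combination this
  apply SU2.ext_col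
  · rw [SU2.mul_zero_zero P, Submonoid.coe_mul, Matrix.mul_apply, Fin.sum_univ_two,
      SU2.mk_zero_zero, SU2.mk_one_zero, SU2.diag_zero_zero, SU2.diag_one_zero, ← hM]
    linear_combination (s : ℂ)⁻¹ * hrow 0
  · rw [SU2.mul_one_zero P, Submonoid.coe_mul, Matrix.mul_apply, Fin.sum_univ_two,
      SU2.mk_zero_zero, SU2.mk_one_zero, SU2.diag_zero_zero, SU2.diag_one_zero, ← hM]
    linear_combination (s : ℂ)⁻¹ * hrow 1

/-- The real parts of the roots of unity. -/
def unityCosines : Set ℝ := {x | ∃ z : ℂ, (∃ m : ℕ, 0 < m ∧ z ^ m = 1) ∧ z.re = x}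

/-- Two non-commuting elements of `SU(2)` with the same rotation angle, not a rational multiple
of `π`, generate. -/
theorem generates_of_not_commute {A B : SU 2}
    (hA : cosAngle (A : Matrix (Fin 2) (Fin 2) ℂ) ∉ unityCosines)
    (hAB : cosAngle (A : Matrix (Fin 2) (Fin 2) ℂ) = cosAngle (B : Matrix (Fin 2) (Fin 2) ℂ))
    (hcomm : A * B ≠ B * A) : Generates A B := by
  have habs : |cosAngle (A : Matrix (Fin 2) (Fin 2) ℂ)| ≤ 1 := by
    rw [cosAngle_eq]
    exact (Complex.abs_re_le_norm _).trans (SU.norm_entry_le_one A 0 0)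
  set x := cosAngle (A : Matrix (Fin 2) (Fin 2) ℂ) with hx
  set θ := Real.arccos x
  have hre : ((Circle.exp θ : Circle) : ℂ).re = x := by
    rw [Circle.coe_exp, Complex.exp_ofReal_mul_I_re,
      Real.cos_arccos (abs_le.1 habs).1 (abs_le.1 habs).2]
  have hroot : ∀ m : ℕ, 0 < m → Circle.exp θ ^ m ≠ 1 := by
    intro m hm h
    refine hA ⟨_, ⟨m, hm, ?_⟩, hre⟩
    rw [← Circle.coe_pow, h, Circle.coe_one]
  obtain ⟨P, hP⟩ := exists_diagonalization A (Circle.exp θ) hre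
  set H := (Subgroup.closure {A, B}).topologicalClosure with hH
  have hAH : A ∈ H := Subgroup.le_topologicalClosure _ (Subgroup.subset_closure (by simp))
  have hBH : B ∈ H := Subgroup.le_topologicalClosure _ (Subgroup.subset_closure (by simp))
  have hHc : IsClosed (H : Set (SU 2)) := Subgroup.isClosed_topologicalClosure _
  let G : Subgroup (SU 2) := H.comap (MulAut.conj P).toMonoidHom
  have hmem : ∀ U : SU 2, U ∈ G ↔ P * U * P⁻¹ ∈ H := fun U => Iff.rfl
  have hconj : ∀ U ∈ H, P⁻¹ * U * P ∈ G := by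
    intro U hU
    rw [hmem]
    simpa [mul_assoc] using hU
  have hGc : IsClosed (G : Set (SU 2)) :=
    hHc.preimage ((continuous_const.mul continuous_id).mul continuous_const)
  have hT : ∀ z, SU2.diag z ∈ G := by
    have hcl : IsClosed (SU2.diag ⁻¹' (G : Set (SU 2))) := hGc.preimage SU2.continuous_diag
    let D : Circle →* SU 2 := ⟨⟨SU2.diag, SU2.diag_one⟩, SU2.diag_mul⟩
    refine fun z => Circle.exp_mem_of_isClosed hroot hcl (fun m => ?_) z
    change D (Circle.exp θ ^ m) ∈ G
    rw [map_zpow]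
    refine G.zpow_mem ?_ m
    change SU2.diag _ ∈ G
    rw [← hP]
    exact hconj A hAH
  have hne : P⁻¹ * A * P * (P⁻¹ * B * P) ≠ P⁻¹ * B * P * (P⁻¹ * A * P) := by
    intro h
    apply hcomm
    have h2 := congrArg (fun W => P * W * P⁻¹) h
    simpa [mul_assoc] using h2
  have hcosB : cosAngle ((P⁻¹ * B * P : SU 2) : Matrix (Fin 2) (Fin 2) ℂ) = x := by
    rw [cosAngle_conj, hAB]
  have hG : G = ⊤ := by
    -- A vanishing first entry would give cosine `0 = Re i`, with `i` a root of unity; a vanishing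
    -- lower entry would make the conjugate of `B` diagonal, hence commuting with that of `A`.
    refine eq_top_of_torus_le hGc hT (hconj B hBH) (fun h0 => ?_) (fun h1 => ?_)
    · rw [cosAngle_eq, h0, Complex.zero_re] at hcosB
      exact hA ⟨Complex.I, ⟨4, by norm_num, Complex.I_pow_four⟩, by rw [Complex.I_re, hcosB]⟩
    · apply hne
      rw [hP]
      generalize P⁻¹ * B * P = W at h1
      apply SU2.ext_col
      · rw [SU2.mul_zero_zero, SU2.mul_zero_zero, h1, SU2.diag_one_zero]
        ring
      · rw [SU2.mul_one_zero, SU2.mul_one_zero, h1, SU2.diag_one_zero]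
        ring
  rw [Generates, eq_top_iff]
  intro W _
  have : P⁻¹ * W * P ∈ G := by
    rw [hG]
    trivial
  rw [hmem] at this
  simpa [mul_assoc] using this

end Dense

/-! ### Null sets of `SU(2)` -/

section Null

/-- A measurable set is null if almost every orbit of a sequence of measure preserving maps meets
it finitely often. -/
theorem measure_eq_zero_of_finite_hits {α : Type*} [MeasurableSpace α] {μ : Measure α}
    [IsFiniteMeasure μ] {E : Set α} (hE : MeasurableSet E) {τ : ℕ → α → α}
    (hτ : ∀ n, MeasurePreserving (τ n) μ μ) (h : ∀ᵐ p ∂μ, {n | τ n p ∈ E}.Finite) : μ E = 0 := by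
  -- The tail unions decrease to the null set of points with infinitely many hits, yet each has
  -- measure at least that of `E`.
  let F : ℕ → Set α := fun n => ⋃ m ≥ n, τ m ⁻¹' E
  have hF : ∀ n, MeasurableSet (F n) := fun n =>
    MeasurableSet.iUnion fun m => MeasurableSet.iUnion fun _ => (hτ m).measurable hE
  have hanti : Antitone F := fun a b hab =>
    Set.iUnion_mono fun m => Set.iUnion_subset fun hm =>
      Set.subset_iUnion_of_subset (hab.trans hm) subset_rfl
  have hlim := tendsto_measure_iInter_atTop (μ := μ) (fun n => (hF n).nullMeasurableSet) hanti
    ⟨0, measure_ne_top _ _⟩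
  have hzero : μ (⋂ n, F n) = 0 := by
    refine measure_mono_null (fun p hp => ?_) (ae_iff.1 h)
    intro hfin
    obtain ⟨N, hN⟩ := hfin.bddAbove
    obtain ⟨m, hm, hmE⟩ := Set.mem_iUnion₂.1 (Set.mem_iInter.1 hp (N + 1))
    have := hN (show m ∈ {n | τ n p ∈ E} from hmE)
    omega
  rw [hzero] at hlim
  refine le_antisymm (ge_of_tendsto' hlim fun n => ?_) zero_le
  rw [← (hτ n).measure_preimage hE.nullMeasurableSet]
  exact measure_mono (Set.subset_iUnion₂_of_subset n le_rfl subset_rfl)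

/-- A coincidence would make `π` rational. Hence a nonzero polynomial vanishes at only finitely many
`e^{in}`. -/
theorem Circle.exp_natCast_injective : Function.Injective fun n : ℕ => (Circle.exp n : ℂ) := by
  intro m n h
  simp only [Circle.coe_exp] at h
  obtain ⟨k, hk⟩ := Complex.exp_eq_exp_iff_exists_int.1 h
  have h1 : ((m : ℂ)) = n + k * (2 * Real.pi) :=
    mul_right_cancel₀ Complex.I_ne_zero (by
      rw [Complex.ofReal_natCast] at hk
      simpa [add_mul, mul_assoc] using hk)
  have h2 : (m : ℝ) = n + k * (2 * Real.pi) := by exact_mod_cast h1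
  rcases eq_or_ne k 0 with rfl | hk0
  · simpa using h2
  · exfalso
    refine irrational_pi ⟨((m : ℚ) - n) / (k * 2), ?_⟩
    have : (k : ℝ) ≠ 0 := by exact_mod_cast hk0
    push_cast
    rw [h2]
    field_simp
    ring

theorem finite_setOf_eval_exp_eq_zero {p : Polynomial ℂ} (hp : p ≠ 0) :
    {n : ℕ | p.eval (Circle.exp n : ℂ) = 0}.Finite :=
  ((Polynomial.finite_setOfPred_isRoot hp).preimage Circle.exp_natCast_injective.injOn)

instance SU.instSecondCountableTopology (d : ℕ) : SecondCountableTopology (SU d) := by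
  have : SecondCountableTopology (Matrix (Fin d) (Fin d) ℂ) :=
    inferInstanceAs (SecondCountableTopology (Fin d → Fin d → ℂ))
  exact Topology.IsEmbedding.subtypeVal.secondCountableTopology

/-- The real rotation by the angle `θ`. -/
noncomputable def SU2.rot (θ : ℝ) : SU 2 :=
  SU2.mk (Real.cos θ) (Real.sin θ) (by
    rw [Complex.normSq_ofReal, Complex.normSq_ofReal]
    linarith [Real.cos_sq_add_sin_sq θ])

/-- With `w = e^{in}`, the expression times `2w` is `(a - ib) w² + (a + ib)`. -/
theorem finite_cos_add_sin {a b : ℂ} (h : a ≠ 0 ∨ b ≠ 0) :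
    {n : ℕ | (Real.cos n : ℂ) * a + (Real.sin n : ℂ) * b = 0}.Finite := by
  have hp : Polynomial.C (a - Complex.I * b) * Polynomial.X ^ 2 +
      Polynomial.C (a + Complex.I * b) ≠ 0 := by
    intro h0
    have h1 := congrArg (Polynomial.coeff · 2) h0
    have h2 := congrArg (Polynomial.coeff · 0) h0
    simp [Polynomial.coeff_C, -map_sub, -map_add, -map_mul] at h1 h2
    have ha : a = 0 := by linear_combination (h1 + h2) / 2
    have hb : b = 0 := by
      linear_combination Complex.I * (h1 - h2) / 2 + b * Complex.I_sq
    simp [ha, hb] at h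
  refine (finite_setOf_eval_exp_eq_zero hp).subset fun n hn => ?_
  have hn' : (Real.cos n : ℂ) * a + (Real.sin n : ℂ) * b = 0 := hn
  have hcs : (Real.cos n : ℂ) ^ 2 + (Real.sin n : ℂ) ^ 2 = 1 := by
    exact_mod_cast Real.cos_sq_add_sin_sq n
  have he : (Circle.exp n : ℂ) = (Real.cos n : ℂ) + (Real.sin n : ℂ) * Complex.I := by
    rw [Circle.coe_exp, Complex.exp_mul_I, Complex.ofReal_cos, Complex.ofReal_sin]
  simp only [Set.mem_ofPred_eq, Polynomial.eval_add, Polynomial.eval_mul, Polynomial.eval_C,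
    Polynomial.eval_pow, Polynomial.eval_X, he]
  generalize (Real.cos n : ℂ) = c at *
  generalize (Real.sin n : ℂ) = s at *
  linear_combination 2 * (c + s * Complex.I) * hn' - (a + Complex.I * b) * hcs +
    (s ^ 2 * a - 2 * s * c * b - s ^ 2 * b * Complex.I) * Complex.I_sq

/-- Left translation by `SU2.rot n` rotates the nonzero first column by the angle `n`. -/
theorem ae_entries_ne_zero : ∀ᵐ U : SU 2 ∂(SU.haar 2),
    (U : Matrix (Fin 2) (Fin 2) ℂ) 0 0 ≠ 0 ∧ (U : Matrix (Fin 2) (Fin 2) ℂ) 1 0 ≠ 0 := by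
  have hne : ∀ U : SU 2, (U : Matrix (Fin 2) (Fin 2) ℂ) 0 0 ≠ 0 ∨
      (U : Matrix (Fin 2) (Fin 2) ℂ) 1 0 ≠ 0 := by
    intro U
    by_contra! h
    have := SU2.normSq_add_normSq U
    simp [h.1, h.2] at this
  refine Filter.eventually_and.2 ⟨ae_iff.2 ?_, ae_iff.2 ?_⟩
  · refine measure_eq_zero_of_finite_hits (τ := fun n U => SU2.rot n * U) ?_
      (fun n => measurePreserving_mul_left _ _) (Filter.Eventually.of_forall fun U => ?_)
    · simp only [not_not]
      exact (isClosed_eq (continuous_entry 0 0) continuous_const).measurableSet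
    · refine (finite_cos_add_sin (a := (U : Matrix (Fin 2) (Fin 2) ℂ) 0 0)
        (b := -(U : Matrix (Fin 2) (Fin 2) ℂ) 1 0) (by simpa using hne U)).subset fun n hn => ?_
      have h : ((SU2.rot n * U : SU 2) : Matrix (Fin 2) (Fin 2) ℂ) 0 0 = 0 := by simpa using hn
      rw [SU2.mul_zero_zero, SU2.rot, SU2.mk_zero_zero, SU2.mk_one_zero, Complex.star_def,
        Complex.conj_ofReal] at h
      rw [Set.mem_ofPred_eq, ← h]
      ring
  · refine measure_eq_zero_of_finite_hits (τ := fun n U => SU2.rot n * U) ?_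
      (fun n => measurePreserving_mul_left _ _) (Filter.Eventually.of_forall fun U => ?_)
    · simp only [not_not]
      exact (isClosed_eq (continuous_entry 1 0) continuous_const).measurableSet
    · refine (finite_cos_add_sin (a := (U : Matrix (Fin 2) (Fin 2) ℂ) 1 0)
        (b := (U : Matrix (Fin 2) (Fin 2) ℂ) 0 0) (hne U).symm).subset fun n hn => ?_
      have h : ((SU2.rot n * U : SU 2) : Matrix (Fin 2) (Fin 2) ℂ) 1 0 = 0 := by simpa using hn
      rw [SU2.mul_one_zero, SU2.rot, SU2.mk_zero_zero, SU2.mk_one_zero, Complex.star_def,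
        Complex.conj_ofReal] at h
      rw [Set.mem_ofPred_eq, ← h]
      ring

/-- Translation by `diag(w)`, `w = e^{in}`, turns the condition into `Re (w u) = x`, that is `u w² -
2 x w + star u = 0`, with `u ≠ 0` almost surely. -/
theorem ae_cosAngle_ne (x : ℝ) :
    ∀ᵐ U : SU 2 ∂(SU.haar 2), cosAngle (U : Matrix (Fin 2) (Fin 2) ℂ) ≠ x := by
  refine ae_iff.2 (measure_eq_zero_of_finite_hits (τ := fun n U => SU2.diag (Circle.exp n) * U) ?_
      (fun n => measurePreserving_mul_left _ _) ?_)
  · simp only [not_not, cosAngle_eq]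
    exact (isClosed_eq (Complex.continuous_re.comp (continuous_entry 0 0))
      continuous_const).measurableSet
  · filter_upwards [ae_entries_ne_zero] with U hU
    set u := (U : Matrix (Fin 2) (Fin 2) ℂ) 0 0 with hu
    have hp : Polynomial.C u * Polynomial.X ^ 2 - Polynomial.C (2 * x : ℂ) * Polynomial.X +
        Polynomial.C (star u) ≠ 0 := by
      intro h0
      have h1 := congrArg (Polynomial.coeff · 2) h0
      simp [-map_mul] at h1
      exact hU.1 h1
    refine (finite_setOf_eval_exp_eq_zero hp).subset fun n hn => ?_
    have h : cosAngle ((SU2.diag (Circle.exp n) * U : SU 2) : Matrix (Fin 2) (Fin 2) ℂ) = x := by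
      simpa using hn
    rw [cosAngle_eq, SU2.mul_zero_zero, SU2.diag_zero_zero, SU2.diag_one_zero, star_zero,
      zero_mul, sub_zero, ← hu] at h
    have hw : (Circle.exp n : ℂ) * star (Circle.exp n : ℂ) = 1 := by
      rw [← starRingEnd_apply, Complex.mul_conj, Circle.normSq_coe, Complex.ofReal_one]
    have h2 := Complex.add_conj ((Circle.exp n : ℂ) * u)
    rw [h, starRingEnd_apply, star_mul] at h2
    rw [Complex.ofReal_mul, Complex.ofReal_ofNat] at h2
    simp only [Set.mem_ofPred_eq, Polynomial.eval_add, Polynomial.eval_mul, Polynomial.eval_C,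
      Polynomial.eval_pow, Polynomial.eval_X, Polynomial.eval_sub]
    linear_combination (Circle.exp n : ℂ) * h2 - star u * hw

theorem countable_unityCosines : unityCosines.Countable := by
  have h : unityCosines ⊆ ⋃ m : ℕ, Complex.re '' {z : ℂ | 0 < m ∧ z ^ m = 1} := by
    rintro x ⟨z, ⟨m, hm, hz⟩, rfl⟩
    exact Set.mem_iUnion.2 ⟨m, z, ⟨hm, hz⟩, rfl⟩
  refine (Set.countable_iUnion fun m => Set.Countable.image (Set.Finite.countable ?_) _).mono h
  rcases m.eq_zero_or_pos with rfl | hm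
  · simp
  · refine (Polynomial.finite_setOfPred_isRoot
      (Polynomial.X_pow_sub_C_ne_zero hm (1 : ℂ))).subset ?_
    rintro z ⟨-, hz⟩
    simp [Polynomial.IsRoot, hz]

theorem ae_cosAngle_notMem_unityCosines :
    ∀ᵐ U : SU 2 ∂(SU.haar 2), cosAngle (U : Matrix (Fin 2) (Fin 2) ℂ) ∉ unityCosines := by
  have := (ae_ball_iff countable_unityCosines).2 fun x _ => ae_cosAngle_ne x
  filter_upwards [this] with U hU hmem
  exact hU _ hmem rfl

/-- The shear `(A, B) ↦ (A, A B)` preserves the product measure; almost-sure properties of one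
element thus pass to `A B`. -/
theorem quasiMeasurePreserving_mul :
    Measure.QuasiMeasurePreserving (fun p : SU 2 × SU 2 => p.1 * p.2)
      ((SU.haar 2).prod (SU.haar 2)) (SU.haar 2) :=
  Measure.quasiMeasurePreserving_snd.comp
    (measurePreserving_prod_mul (SU.haar 2) (SU.haar 2)).quasiMeasurePreserving

theorem quasiMeasurePreserving_mul_swap :
    Measure.QuasiMeasurePreserving (fun p : SU 2 × SU 2 => p.2 * p.1)
      ((SU.haar 2).prod (SU.haar 2)) (SU.haar 2) :=
  Measure.quasiMeasurePreserving_snd.comp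
    (measurePreserving_prod_mul_swap (SU.haar 2) (SU.haar 2)).quasiMeasurePreserving

/-- The map `(A, B) ↦ (A D⁻¹, D B)` fixes `A B` and conjugates `B A` by `D = diag(w)`. The upper
left entry of the commutation relation becomes `star v u w⁴ = star u v`, with `u`, `v` the lower
left entries of `A B` and `B A`, nonzero almost surely. -/
theorem ae_not_commute : ∀ᵐ p : SU 2 × SU 2 ∂((SU.haar 2).prod (SU.haar 2)),
    (p.2 * p.1) * (p.1 * p.2) ≠ (p.1 * p.2) * (p.2 * p.1) := by
  let D : ℕ → SU 2 := fun n => SU2.diag (Circle.exp n)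
  refine ae_iff.2 (measure_eq_zero_of_finite_hits
    (τ := fun n p => (p.1 * (D n)⁻¹, D n * p.2)) ?_
    (fun n => (measurePreserving_mul_right _ _).prod (measurePreserving_mul_left _ _)) ?_)
  · simp only [not_not]
    refine (isClosed_eq ?_ ?_).measurableSet <;> fun_prop
  · filter_upwards [quasiMeasurePreserving_mul.ae ae_entries_ne_zero,
      quasiMeasurePreserving_mul_swap.ae ae_entries_ne_zero] with p hU hV
    set U := p.1 * p.2 with hUdef
    set V := p.2 * p.1 with hVdef
    set u := (U : Matrix (Fin 2) (Fin 2) ℂ) 1 0 with hu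
    set v := (V : Matrix (Fin 2) (Fin 2) ℂ) 1 0 with hv
    have hp : Polynomial.C (star v * u) * Polynomial.X ^ 4 - Polynomial.C (star u * v) ≠ 0 := by
      intro h0
      have h1 := congrArg (Polynomial.coeff · 4) h0
      simp [-map_mul] at h1
      exact h1.elim hV.2 hU.2
    refine (finite_setOf_eval_exp_eq_zero hp).subset fun n hn => ?_
    have h : D n * V * (D n)⁻¹ * U = U * (D n * V * (D n)⁻¹) := by
      have : (D n * p.2 * (p.1 * (D n)⁻¹)) * (p.1 * (D n)⁻¹ * (D n * p.2)) =
        (p.1 * (D n)⁻¹ * (D n * p.2)) * (D n * p.2 * (p.1 * (D n)⁻¹)) := by simpa using hn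
      simpa [mul_assoc, hUdef, hVdef] using this
    have hinv : (D n)⁻¹ = SU2.diag (Circle.exp n)⁻¹ := by
      rw [inv_eq_iff_mul_eq_one, ← SU2.diag_mul, mul_inv_cancel, SU2.diag_one]
    have hW : ((D n * V * (D n)⁻¹ : SU 2) : Matrix (Fin 2) (Fin 2) ℂ) 1 0 =
        star (Circle.exp n : ℂ) ^ 2 * v := by
      rw [hinv, SU2.mul_one_zero, SU2.mul_one_zero, SU2.diag_zero_zero, SU2.diag_zero_zero,
        SU2.diag_one_zero, SU2.diag_one_zero, Circle.coe_inv_eq_conj, starRingEnd_apply, ← hv]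
      ring
    have hw : (Circle.exp n : ℂ) * star (Circle.exp n : ℂ) = 1 := by
      rw [← starRingEnd_apply, Complex.mul_conj, Circle.normSq_coe, Complex.ofReal_one]
    have h00 := congrArg (fun W : SU 2 => (W : Matrix (Fin 2) (Fin 2) ℂ) 0 0) h
    simp only [SU2.mul_zero_zero _ U, SU2.mul_zero_zero U, hW, star_mul, star_pow, star_star,
      ← hu] at h00
    simp only [Set.mem_ofPred_eq, Polynomial.eval_sub, Polynomial.eval_mul, Polynomial.eval_C,
      Polynomial.eval_pow, Polynomial.eval_X]
    generalize (Circle.exp n : ℂ) = w at *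
    linear_combination (-w ^ 2) * h00 + star u * v * (w * star w + 1) * hw

end Null

/-! ### Rotation axes -/

section Axes

theorem sinAxis_zero (U : SU 2) : sinAxis (U : Matrix (Fin 2) (Fin 2) ℂ) 0 =
    -((U : Matrix (Fin 2) (Fin 2) ℂ) 1 0).im := by
  simp [sinAxis, pauli, Matrix.trace_fin_two, Matrix.mul_apply, Fin.sum_univ_two,
    SU2.apply_zero_one]

theorem sinAxis_one (U : SU 2) : sinAxis (U : Matrix (Fin 2) (Fin 2) ℂ) 1 =
    ((U : Matrix (Fin 2) (Fin 2) ℂ) 1 0).re := by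
  simp [sinAxis, pauli, Matrix.trace_fin_two, Matrix.mul_apply, Fin.sum_univ_two,
    SU2.apply_zero_one]

theorem sinAxis_two (U : SU 2) : sinAxis (U : Matrix (Fin 2) (Fin 2) ℂ) 2 =
    -((U : Matrix (Fin 2) (Fin 2) ℂ) 0 0).im := by
  simp [sinAxis, pauli, Matrix.trace_fin_two, Matrix.mul_apply, Fin.sum_univ_two,
    SU2.apply_one_one]

theorem inner_fin_three (x y : EuclideanSpace ℝ (Fin 3)) :
    inner ℝ x y = x 0 * y 0 + x 1 * y 1 + x 2 * y 2 := by
  simp [PiLp.inner_apply, Fin.sum_univ_three]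
  ring

theorem cosAngle_sq_add_norm_sinAxis_sq (U : SU 2) :
    cosAngle (U : Matrix (Fin 2) (Fin 2) ℂ) ^ 2 +
      ‖sinAxis (U : Matrix (Fin 2) (Fin 2) ℂ)‖ ^ 2 = 1 := by
  have h := SU2.normSq_add_normSq U
  rw [Complex.normSq_apply, Complex.normSq_apply] at h
  rw [← real_inner_self_eq_norm_sq, inner_fin_three, cosAngle_eq, sinAxis_zero, sinAxis_one,
    sinAxis_two]
  linarith

theorem cosAngle_mul_comm (A B : SU 2) :
    cosAngle ((A * B : SU 2) : Matrix (Fin 2) (Fin 2) ℂ) =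
      cosAngle ((B * A : SU 2) : Matrix (Fin 2) (Fin 2) ℂ) := by
  rw [cosAngle, cosAngle, Submonoid.coe_mul, Submonoid.coe_mul, Matrix.trace_mul_comm]

/-- In the quaternion product the cross product is antisymmetric and cancels. The line of `a_n +
b_n` is thus preserved by the recursion. -/
theorem sinAxis_mul_add_sinAxis_mul {A B : SU 2}
    (h : cosAngle (A : Matrix (Fin 2) (Fin 2) ℂ) = cosAngle (B : Matrix (Fin 2) (Fin 2) ℂ)) :
    sinAxis ((B * A : SU 2) : Matrix (Fin 2) (Fin 2) ℂ) +
        sinAxis ((A * B : SU 2) : Matrix (Fin 2) (Fin 2) ℂ) =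
      (2 * cosAngle (A : Matrix (Fin 2) (Fin 2) ℂ)) •
        (sinAxis (A : Matrix (Fin 2) (Fin 2) ℂ) + sinAxis (B : Matrix (Fin 2) (Fin 2) ℂ)) := by
  rw [cosAngle_eq, cosAngle_eq] at h
  rw [cosAngle_eq]
  ext j
  fin_cases j
  · simp [sinAxis_zero, SU2.mul_one_zero, -MulMemClass.coe_mul, -Submonoid.coe_mul]
    linear_combination 2 * ((A : Matrix (Fin 2) (Fin 2) ℂ) 1 0).im * h
  · simp [sinAxis_one, SU2.mul_one_zero, -MulMemClass.coe_mul, -Submonoid.coe_mul]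
    linear_combination (-2) * ((A : Matrix (Fin 2) (Fin 2) ℂ) 1 0).re * h
  · simp [sinAxis_two, SU2.mul_zero_zero, -MulMemClass.coe_mul, -Submonoid.coe_mul]
    linear_combination 2 * ((A : Matrix (Fin 2) (Fin 2) ℂ) 0 0).im * h

/-- The two axis vectors differ by a multiple of `a × b = a × (a + b) = l (a × z)`, which is
orthogonal to `z`. -/
theorem inner_sinAxis_mul_eq {A B : SU 2} {z : EuclideanSpace ℝ (Fin 3)} {l : ℝ}
    (h : sinAxis (A : Matrix (Fin 2) (Fin 2) ℂ) + sinAxis (B : Matrix (Fin 2) (Fin 2) ℂ) = l • z) :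
    inner ℝ (sinAxis ((B * A : SU 2) : Matrix (Fin 2) (Fin 2) ℂ)) z =
      inner ℝ (sinAxis ((A * B : SU 2) : Matrix (Fin 2) (Fin 2) ℂ)) z := by
  have h0 := congrArg (fun v : EuclideanSpace ℝ (Fin 3) => v 0) h
  have h1 := congrArg (fun v : EuclideanSpace ℝ (Fin 3) => v 1) h
  have h2 := congrArg (fun v : EuclideanSpace ℝ (Fin 3) => v 2) h
  simp only [PiLp.add_apply, PiLp.smul_apply, smul_eq_mul, sinAxis_zero, sinAxis_one,
    sinAxis_two] at h0 h1 h2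
  rw [inner_fin_three, inner_fin_three]
  simp [sinAxis_zero, sinAxis_one, sinAxis_two, SU2.mul_one_zero, SU2.mul_zero_zero,
    -MulMemClass.coe_mul, -Submonoid.coe_mul]
  set p := (A : Matrix (Fin 2) (Fin 2) ℂ) 0 0
  set q := (A : Matrix (Fin 2) (Fin 2) ℂ) 1 0
  linear_combination 2 * (-p.im * h1 - q.re * h2) * z 0 + 2 * (-q.im * h2 + p.im * h0) * z 1 +
    2 * (q.re * h0 + q.im * h1) * z 2

/-- Elements of `SU(2)` with equal rotation angles commute if and only if their axes are parallel,
which can be read off the angle and the sum of the axes. -/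
theorem commute_iff {A B : SU 2}
    (h : cosAngle (A : Matrix (Fin 2) (Fin 2) ℂ) = cosAngle (B : Matrix (Fin 2) (Fin 2) ℂ)) :
    A * B = B * A ↔
      (1 - cosAngle (A : Matrix (Fin 2) (Fin 2) ℂ) ^ 2) ^ 2 =
        (‖sinAxis (A : Matrix (Fin 2) (Fin 2) ℂ) + sinAxis (B : Matrix (Fin 2) (Fin 2) ℂ)‖ ^ 2 / 2 -
          (1 - cosAngle (A : Matrix (Fin 2) (Fin 2) ℂ) ^ 2)) ^ 2 := by
  have hA := cosAngle_sq_add_norm_sinAxis_sq A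
  have hB := cosAngle_sq_add_norm_sinAxis_sq B
  rw [← h] at hB
  -- The difference is the Gram determinant of the axis vectors: both have squared length `1 - cos²
  -- α`, and `‖a + b‖²` gives their inner product.
  have key : (1 - cosAngle (A : Matrix (Fin 2) (Fin 2) ℂ) ^ 2) ^ 2 -
      (‖sinAxis (A : Matrix (Fin 2) (Fin 2) ℂ) + sinAxis (B : Matrix (Fin 2) (Fin 2) ℂ)‖ ^ 2 / 2 -
          (1 - cosAngle (A : Matrix (Fin 2) (Fin 2) ℂ) ^ 2)) ^ 2 =
      inner ℝ (sinAxis (A : Matrix (Fin 2) (Fin 2) ℂ)) (sinAxis (A : Matrix (Fin 2) (Fin 2) ℂ)) *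
      inner ℝ (sinAxis (B : Matrix (Fin 2) (Fin 2) ℂ)) (sinAxis (B : Matrix (Fin 2) (Fin 2) ℂ)) -
      inner ℝ (sinAxis (A : Matrix (Fin 2) (Fin 2) ℂ))
        (sinAxis (B : Matrix (Fin 2) (Fin 2) ℂ)) ^ 2 := by
    rw [norm_add_sq_real, real_inner_self_eq_norm_sq, real_inner_self_eq_norm_sq,
      show ‖sinAxis (A : Matrix (Fin 2) (Fin 2) ℂ)‖ ^ 2 =
        1 - cosAngle (A : Matrix (Fin 2) (Fin 2) ℂ) ^ 2 by linarith,
      show ‖sinAxis (B : Matrix (Fin 2) (Fin 2) ℂ)‖ ^ 2 =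
        1 - cosAngle (A : Matrix (Fin 2) (Fin 2) ℂ) ^ 2 by linarith]
    ring
  rw [← sub_eq_zero (a := (1 - _) ^ 2), key, inner_fin_three, inner_fin_three, inner_fin_three,
    sinAxis_zero, sinAxis_one, sinAxis_two, sinAxis_zero, sinAxis_one, sinAxis_two]
  clear key hA hB h
  set p := (A : Matrix (Fin 2) (Fin 2) ℂ) 0 0 with hp
  set q := (A : Matrix (Fin 2) (Fin 2) ℂ) 1 0 with hq
  set p' := (B : Matrix (Fin 2) (Fin 2) ℂ) 0 0 with hp'
  set q' := (B : Matrix (Fin 2) (Fin 2) ℂ) 1 0 with hq'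
  have hcomm : A * B = B * A ↔ q.re * q'.im - q.im * q'.re = 0 ∧
      q.re * p'.im - p.im * q'.re = 0 ∧ q.im * p'.im - p.im * q'.im = 0 := by
    constructor
    · intro hc
      have h1 := congrArg (fun W : SU 2 => ((W : Matrix (Fin 2) (Fin 2) ℂ) 0 0).im) hc
      have h2 := congrArg (fun W : SU 2 => ((W : Matrix (Fin 2) (Fin 2) ℂ) 1 0).re) hc
      have h3 := congrArg (fun W : SU 2 => ((W : Matrix (Fin 2) (Fin 2) ℂ) 1 0).im) hc
      simp [SU2.mul_zero_zero, SU2.mul_one_zero, ← hp, ← hq, ← hp', ← hq'] at h1 h2 h3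
      refine ⟨?_, ?_, ?_⟩ <;> linarith
    · rintro ⟨h1, h2, h3⟩
      apply SU2.ext_col <;> rw [Complex.ext_iff]
      · simp [SU2.mul_zero_zero, ← hp, ← hq, ← hp', ← hq']
        constructor <;> linarith
      · simp [SU2.mul_one_zero, ← hp, ← hq, ← hp', ← hq']
        constructor <;> linarith
  rw [hcomm]
  -- Lagrange's identity: the Gram determinant is the squared length of the cross product.
  have hL : (-q.im * -q.im + q.re * q.re + -p.im * -p.im) *
      (-q'.im * -q'.im + q'.re * q'.re + -p'.im * -p'.im) -
      (-q.im * -q'.im + q.re * q'.re + -p.im * -p'.im) ^ 2 =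
      (q.re * q'.im - q.im * q'.re) ^ 2 + (q.re * p'.im - p.im * q'.re) ^ 2 +
        (q.im * p'.im - p.im * q'.im) ^ 2 := by ring
  rw [hL]
  constructor
  · rintro ⟨h1, h2, h3⟩
    rw [h1, h2, h3]
    ring
  · intro h
    refine ⟨?_, ?_, ?_⟩ <;> rw [← sq_eq_zero_iff] <;>
      linarith [sq_nonneg (q.re * q'.im - q.im * q'.re), sq_nonneg (q.re * p'.im - p.im * q'.re),
        sq_nonneg (q.im * p'.im - p.im * q'.im)]

/-- For `n ≥ 1`, the axes of `A_n` and `B_n` sum to a multiple of the disk axis, and have the same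
component along it. -/
theorem axes_sum_parallel (A B : SU 2) (n : ℕ) :
    cosAngle (unitaryA A B (n + 1) : Matrix (Fin 2) (Fin 2) ℂ) =
      cosAngle (unitaryB A B (n + 1) : Matrix (Fin 2) (Fin 2) ℂ) ∧
    (∃ l : ℝ, sinAxis (unitaryA A B (n + 1) : Matrix (Fin 2) (Fin 2) ℂ) +
      sinAxis (unitaryB A B (n + 1) : Matrix (Fin 2) (Fin 2) ℂ) = l • diskAxis A B) ∧
    inner ℝ (sinAxis (unitaryA A B (n + 1) : Matrix (Fin 2) (Fin 2) ℂ)) (diskAxis A B) =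
      inner ℝ (sinAxis (unitaryB A B (n + 1) : Matrix (Fin 2) (Fin 2) ℂ)) (diskAxis A B) := by
  have hcos : ∀ m, cosAngle (unitaryA A B (m + 1) : Matrix (Fin 2) (Fin 2) ℂ) =
      cosAngle (unitaryB A B (m + 1) : Matrix (Fin 2) (Fin 2) ℂ) := fun m => by
    rw [unitaryA_succ, unitaryB_succ, cosAngle_mul_comm]
  refine ⟨hcos n, ?_⟩
  induction n with
  | zero =>
    set a := sinAxis (unitaryA A B 1 : Matrix (Fin 2) (Fin 2) ℂ) with ha
    set b := sinAxis (unitaryB A B 1 : Matrix (Fin 2) (Fin 2) ℂ) with hb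
    have hz : diskAxis A B = ‖a + b‖⁻¹ • (a + b) := rfl
    constructor
    · refine ⟨‖a + b‖, ?_⟩
      rw [hz, smul_smul]
      rcases eq_or_ne (a + b) 0 with h | h
      · rw [h, smul_zero]
      · rw [mul_inv_cancel₀ (norm_ne_zero_iff.2 h), one_smul]
    · have h1 := cosAngle_sq_add_norm_sinAxis_sq (unitaryA A B 1)
      have h2 := cosAngle_sq_add_norm_sinAxis_sq (unitaryB A B 1)
      rw [hcos 0, ← ha] at h1
      rw [← hb] at h2
      rw [hz, inner_smul_right, inner_smul_right, inner_add_right, inner_add_right,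
        real_inner_self_eq_norm_sq, real_inner_self_eq_norm_sq, real_inner_comm b a,
        show ‖a‖ ^ 2 = ‖b‖ ^ 2 by linarith, add_comm (‖b‖ ^ 2)]
  | succ n ih =>
    obtain ⟨⟨l, hl⟩, -⟩ := ih
    rw [unitaryA_succ A B (n + 1), unitaryB_succ A B (n + 1)]
    refine ⟨⟨2 * cosAngle (unitaryA A B (n + 1) : Matrix (Fin 2) (Fin 2) ℂ) * l, ?_⟩,
      inner_sinAxis_mul_eq hl⟩
    rw [sinAxis_mul_add_sinAxis_mul (hcos n), hl, smul_smul]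

theorem norm_diskAxis (A B : SU 2) : diskAxis A B = 0 ∨ ‖diskAxis A B‖ = 1 := by
  rcases eq_or_ne (sinAxis (unitaryA A B 1 : Matrix (Fin 2) (Fin 2) ℂ) +
    sinAxis (unitaryB A B 1 : Matrix (Fin 2) (Fin 2) ℂ)) 0 with h | h
  · left
    simp [diskAxis, h]
  · right
    exact norm_smul_inv_norm (𝕜 := ℝ) h

/-- Both axis vectors have component `Im c_n` along the disk axis, and their sum is parallel to it.
-/
theorem axes_sum_eq (A B : SU 2) {n : ℕ} (hn : 1 ≤ n) :
    sinAxis (unitaryA A B n : Matrix (Fin 2) (Fin 2) ℂ) +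
      sinAxis (unitaryB A B n : Matrix (Fin 2) (Fin 2) ℂ) =
    (2 * (diskCoord A B n).im) • diskAxis A B := by
  obtain ⟨n, rfl⟩ := Nat.exists_eq_add_of_le' hn
  obtain ⟨-, ⟨l, hl⟩, hi⟩ := axes_sum_parallel A B n
  rw [hl]
  rcases norm_diskAxis A B with h | h
  · rw [h, smul_zero, smul_zero]
  · have h1 := congrArg (fun v => inner ℝ v (diskAxis A B)) hl
    simp only [inner_add_left, real_inner_smul_left, real_inner_self_eq_norm_sq, h, ← hi] at h1
    have h2 : (diskCoord A B (n + 1)).im =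
        inner ℝ (sinAxis (unitaryA A B (n + 1) : Matrix (Fin 2) (Fin 2) ℂ)) (diskAxis A B) := by
      simp [diskCoord]
    rw [h2, two_mul, h1]
    ring_nf

theorem re_diskCoord (A B : SU 2) (n : ℕ) : (diskCoord A B n).re =
    cosAngle (unitaryA A B n : Matrix (Fin 2) (Fin 2) ℂ) := by
  simp [diskCoord]

/-- The rotation angles and the sum of the rotation axes of a pair. -/
noncomputable def angleData (p : SU 2 × SU 2) : (ℝ × ℝ) × EuclideanSpace ℝ (Fin 3) :=
  ((cosAngle (p.1 : Matrix (Fin 2) (Fin 2) ℂ), cosAngle (p.2 : Matrix (Fin 2) (Fin 2) ℂ)),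
    sinAxis (p.1 : Matrix (Fin 2) (Fin 2) ℂ) + sinAxis (p.2 : Matrix (Fin 2) (Fin 2) ℂ))

theorem continuous_cosAngle :
    Continuous fun U : SU 2 => cosAngle (U : Matrix (Fin 2) (Fin 2) ℂ) := by
  simp only [cosAngle_eq]
  exact Complex.continuous_re.comp (continuous_entry 0 0)

theorem continuous_sinAxis :
    Continuous fun U : SU 2 => sinAxis (U : Matrix (Fin 2) (Fin 2) ℂ) := by
  refine (PiLp.continuous_toLp 2 _).comp (continuous_pi fun j => ?_)
  have h : Continuous fun U : SU 2 => (pauli j * (U : Matrix (Fin 2) (Fin 2) ℂ)).trace :=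
    (continuous_const.matrix_mul continuous_subtype_val).matrix_trace
  exact Complex.continuous_re.comp ((continuous_const.mul h).div_const 2)

theorem continuous_angleData : Continuous angleData :=
  ((continuous_cosAngle.comp continuous_fst).prodMk
    (continuous_cosAngle.comp continuous_snd)).prodMk
    ((continuous_sinAxis.comp continuous_fst).add (continuous_sinAxis.comp continuous_snd))

/-- The angle data are `Re c_n`, twice, and `2 Im c_n` times a fixed vector of norm at most `1`;
hence the factor `2`. -/
theorem dist_angleData_le (A B : SU 2) {n : ℕ} (hn : 1 ≤ n) :
    dist (angleData (unitaryA A B n, unitaryB A B n))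
      (angleData (unitaryA A B 1, unitaryB A B 1)) ≤
        2 * ‖diskCoord A B n - diskCoord A B 1‖ := by
  have hcos : ∀ {m : ℕ}, 1 ≤ m → cosAngle (unitaryB A B m : Matrix (Fin 2) (Fin 2) ℂ) =
      (diskCoord A B m).re := by
    intro m hm
    obtain ⟨m, rfl⟩ := Nat.exists_eq_add_of_le' hm
    rw [re_diskCoord, (axes_sum_parallel A B m).1]
  simp only [angleData, ← re_diskCoord, hcos hn, hcos le_rfl, axes_sum_eq A B hn,
    axes_sum_eq A B le_rfl]
  have hre := Complex.abs_re_le_norm (diskCoord A B n - diskCoord A B 1)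
  have him := Complex.abs_im_le_norm (diskCoord A B n - diskCoord A B 1)
  have h0 := norm_nonneg (diskCoord A B n - diskCoord A B 1)
  have hz : ‖diskAxis A B‖ ≤ 1 := by
    rcases norm_diskAxis A B with h | h
    · simp [h]
    · exact h.le
  have hre' : dist (diskCoord A B n).re (diskCoord A B 1).re ≤
      2 * ‖diskCoord A B n - diskCoord A B 1‖ := by
    rw [Real.dist_eq, ← Complex.sub_re]
    linarith
  refine max_le (max_le hre' hre') ?_
  rw [dist_eq_norm, ← sub_smul, ← mul_sub, ← Complex.sub_im, norm_smul, norm_mul,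
    Real.norm_eq_abs, Real.norm_eq_abs, abs_two]
  exact (mul_le_of_le_one_right (by positivity) hz).trans
    (mul_le_mul_of_nonneg_left him zero_le_two)

/-- By `commute_iff` the generation criterion depends only on the angle data, so it holds along a
whole fibre. -/
theorem generates_of_angleData_eq {A B : SU 2} {p : SU 2 × SU 2}
    (hA : cosAngle (A : Matrix (Fin 2) (Fin 2) ℂ) ∉ unityCosines)
    (hAB : cosAngle (A : Matrix (Fin 2) (Fin 2) ℂ) = cosAngle (B : Matrix (Fin 2) (Fin 2) ℂ))
    (hcomm : A * B ≠ B * A) (hp : angleData p = angleData (A, B)) : Generates p.1 p.2 := by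
  simp only [angleData, Prod.mk.injEq] at hp
  obtain ⟨⟨h1, h2⟩, h3⟩ := hp
  have h12 : cosAngle (p.1 : Matrix (Fin 2) (Fin 2) ℂ) =
      cosAngle (p.2 : Matrix (Fin 2) (Fin 2) ℂ) := by rw [h1, h2, hAB]
  refine generates_of_not_commute (by rwa [h1]) h12 fun hc => hcomm ?_
  rw [commute_iff hAB, ← h1, ← h3]
  exact (commute_iff h12).1 hc

/-- Contraction at the returns of the disk coordinate. -/
theorem exists_contraction_of_return (k : ℕ) {A B : SU 2}
    (hA : cosAngle ((B * A : SU 2) : Matrix (Fin 2) (Fin 2) ℂ) ∉ unityCosines)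
    (hcomm : (B * A) * (A * B) ≠ (A * B) * (B * A)) :
    ∃ ε : ℝ, 0 < ε ∧ ∃ δ : ℝ, 0 < δ ∧ ∀ n : ℕ, 1 ≤ n →
      ‖diskCoord A B n - diskCoord A B 1‖ < ε →
        monotone k A B (n + 3) ≤ (1 - δ) * monotone k A B n := by
  have hA1 : unitaryA A B 1 = B * A := by
    rw [unitaryA_succ, unitaryB_eq_unitaryA, unitaryA_zero, unitaryA_zero]
  have hB1 : unitaryB A B 1 = A * B := by
    rw [unitaryB_succ, unitaryB_eq_unitaryA, unitaryA_zero, unitaryA_zero]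
  set x := angleData (B * A, A * B) with hx
  have hK : IsCompact (angleData ⁻¹' {x}) :=
    (isClosed_singleton.preimage continuous_angleData).isCompact
  obtain ⟨Ω, hΩ, hKΩ, δ, hδ, h⟩ := exists_monotone_add_three_le k hK
    fun p hp => generates_of_angleData_eq hA (cosAngle_mul_comm B A) hcomm hp
  -- The image of the complement of `Ω` is compact and misses `x`, so data close to `x` force the
  -- pair into `Ω`, although the pair itself need not return near `(A_1, B_1)`.
  have hcl : IsClosed (angleData '' Ωᶜ) :=
    (hΩ.isClosed_compl.isCompact.image continuous_angleData).isClosed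
  have hmem : x ∈ (angleData '' Ωᶜ)ᶜ := by
    rintro ⟨p, hp, hpx⟩
    exact hp (hKΩ hpx)
  obtain ⟨ε, hε, hball⟩ := Metric.isOpen_iff.1 hcl.isOpen_compl x hmem
  refine ⟨ε / 2, half_pos hε, δ, hδ, fun n hn hdist => h A B n ?_⟩
  by_contra hout
  have hd := dist_angleData_le A B hn
  rw [hA1, hB1, ← hx] at hd
  exact hball (Metric.mem_ball.2 (hd.trans_lt (by linarith))) ⟨_, hout, rfl⟩

end Axes

end ThueMorse

open ThueMorse in
theorem mainTheorem3 (k : ℕ) :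
    -- `M_n` is non-increasing, with the equality case
    (∀ (d : ℕ) (A B : SU d) (n : ℕ),
      monotone k A B (n + 1) ≤ monotone k A B n ∧
      (monotone k A B (n + 1) = monotone k A B n ↔
        (timeAverage k A B (2 ^ (n + 1)) = timeAverage k A B (2 ^ n) ∧
          timeAverage k A B (2 ^ n) =
            timeAverageBar k A B (2 ^ n) ∘ₗ unitaryChannel k (unitaryA A B n)) ∧
        (timeAverageBar k A B (2 ^ (n + 1)) = timeAverageBar k A B (2 ^ n) ∧
          timeAverageBar k A B (2 ^ n) =
            timeAverage k A B (2 ^ n) ∘ₗ unitaryChannel k (unitaryB A B n)))) ∧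
    -- uniform contraction near a compact set of generating pairs
    (∀ (d : ℕ) (K : Set (SU d × SU d)), IsCompact K → (∀ p ∈ K, Generates p.1 p.2) →
      ∃ Ω : Set (SU d × SU d), IsOpen Ω ∧ K ⊆ Ω ∧ ∃ δ : ℝ, 0 < δ ∧
        ∀ (A B : SU d) (n : ℕ), (unitaryA A B n, unitaryB A B n) ∈ Ω →
          monotone k A B (n + 3) ≤ (1 - δ) * monotone k A B n) ∧
    -- contraction at the returns of the disk coordinate, for a single qubit
    (∀ᵐ p : SU 2 × SU 2 ∂((SU.haar 2).prod (SU.haar 2)),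
      ∃ ε : ℝ, 0 < ε ∧ ∃ δ : ℝ, 0 < δ ∧ ∀ n : ℕ, 1 ≤ n →
        ‖diskCoord p.1 p.2 n - diskCoord p.1 p.2 1‖ < ε →
          monotone k p.1 p.2 (n + 3) ≤ (1 - δ) * monotone k p.1 p.2 n) := by
  refine ⟨fun d A B n => ⟨monotone_succ_le A B n, monotone_succ_eq_iff A B n⟩,
    fun d K hK hgen => exists_monotone_add_three_le k hK hgen, ?_⟩
  filter_upwards [quasiMeasurePreserving_mul_swap.ae ae_cosAngle_notMem_unityCosines,
    ae_not_commute] with p h1 h2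
  exact exists_contraction_of_return k h1 h2
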